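/- Let $B$ be a smooth $n$-manifold (Hausdorff, second countable, without boundary). A closed lattice of rank $k$ on $B$ is a family $P=(P_x)_{x\in B}$ of subgroups $P_x\subset T_x^*B$ that near every point of $B$ is the integral span of $k$ smooth, pointwise linearly independent $1$-forms, and all of whose local smooth sections are closed $1$-forms. An affine fibration with underlying fibration $T^*B/P\to B$ is a smooth manifold $E$ with a map $\pi\colon E\to B$ and a free and transitive action of the group $T_x^*B/P_x$ on each fibre $\pi^{-1}(x)$, such that every point of $B$ has an open neighbourhood $U$ with an equivariant fibrewise diffeomorphism $(T^*B/P)|_U\cong\pi^{-1}(U)$. Two affine fibrations $\pi_i\colon E_i\to B$ $(i=1,2)$ with the same underlying fibration are equivalent if there is a diffeomorphism $E_1\to E_2$ over the identity of $B$ that commutes with the actions. Let $H^2(B,P)$ be the (singular) cohomology of $B$ with coefficients in the local system $P$: a $k$-cochain assigns to each singular simplex $\sigma\colon\Delta^k\to B$ a continuous section of $P$ along $\sigma$, and $(\delta c)(\sigma)=\sum_i(-1)^i q_i$, where $q_i$ is the extension to $\Delta^{k+1}$ of the section $c(\sigma\circ\partial_i)$ given on the $i$-th face. Let $\pi\colon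 E\to B$ be an affine fibration as above. A section of $E$ over the $1$-skeleton consists of a point of $\pi^{-1}(x)$ for each $x\in B$ and, for each path in $B$, a lift of this path to $E$ with the chosen end points. Its obstruction cochain assigns to each singular $2$-simplex $\sigma$ the element of $\pi_1(T^*B/P)=P$ (fundamental group of the fibre) that is represented by the section over the boundary of $\sigma$ in a trivialization of $\sigma^*E$ over $\Delta^2$; thus it is the obstruction to extending the section over $\sigma$. A primary obstruction class of $E$ is the class in $H^2(B,P)$ of an obstruction cochain that is a cocycle. Theorem. Let $P$ be a closed lattice on $B$ and let $\pi_i\colon E_i\to B$, $i=1,2$, be two affine fibrations with underlying fibration $T^*B/P\to B$. Each $E_i$ has exactly one primary obstruction class $\gamma_i\in H^2(B,P)$, and $E_1$ and $E_2$ are equivalent if and only if $\gamma_1=\gamma_2$. -/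

import Mathlib

open Set Topology Bundle
open scoped Manifold ContDiff

noncomputable section

namespace LatticeFibration

/-! ### Cotangent bundle and closed lattices -/

section Lattice

variable {n : ℕ} {B : Type*} [TopologicalSpace B] [ChartedSpace (EuclideanSpace ℝ (Fin n)) B]

/-- The cotangent space of the `n`-manifold `B` at `x`. -/
abbrev Cot (n : ℕ) {B : Type*} [TopologicalSpace B] [ChartedSpace (EuclideanSpace ℝ (Fin n)) B]
    (x : B) : Type :=
  TangentSpace (𝓡 n) x →L[ℝ] Bundle.Trivial B ℝ x

/-- The model fibre of the cotangent bundle. -/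
abbrev CotModel (n : ℕ) : Type := EuclideanSpace ℝ (Fin n) →L[ℝ] ℝ

/-- The total space of the cotangent bundle `T*B`. -/
abbrev CotBundle (n : ℕ) (B : Type*) [TopologicalSpace B]
    [ChartedSpace (EuclideanSpace ℝ (Fin n)) B] : Type _ :=
  TotalSpace (CotModel n) (fun x : B => Cot n x)

/-- The model with corners of the manifold `T*B`. -/
abbrev cotI (n : ℕ) : ModelWithCorners ℝ (EuclideanSpace ℝ (Fin n) × CotModel n)
    (ModelProd (EuclideanSpace ℝ (Fin n)) (CotModel n)) :=
  (𝓡 n).prod 𝓘(ℝ, CotModel n)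

/-- The covector `v` at `x` as a point of `T*B`. -/
abbrev cotPt {x : B} (v : Cot n x) : CotBundle n B := ⟨x, v⟩

variable [IsManifold (𝓡 n) ∞ B]

/-- The `1`-form `α` is smooth on the set `U`. -/
def SmoothFormOn (α : ∀ x : B, Cot n x) (U : Set B) : Prop :=
  ContMDiffOn (𝓡 n) (cotI n) ∞ (fun x => cotPt (α x)) U

/-- The `1`-form `α` written in the chart at `x₀` (the pullback of `α` under the inverse of this
chart). -/
def formInChart (α : ∀ x : B, Cot n x) (x₀ : B) (u : EuclideanSpace ℝ (Fin n)) : CotModel n :=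
  (α ((extChartAt (𝓡 n) x₀).symm u)).comp
    (mfderiv (𝓡 n) (𝓡 n) (extChartAt (𝓡 n) x₀).symm u)

/-- `dα = 0` on `U`: at every point `x` of `U`, in the chart at `x`,
`dα (v, w) = (∂_v α) w - (∂_w α) v` vanishes. Meant for open `U` and forms smooth on `U`. -/
def ClosedFormOn (α : ∀ x : B, Cot n x) (U : Set B) : Prop :=
  ∀ x ∈ U, ∀ v w : EuclideanSpace ℝ (Fin n),
    fderiv ℝ (formInChart α x) (extChartAt (𝓡 n) x x) v w
      - fderiv ℝ (formInChart α x) (extChartAt (𝓡 n) x x) w v = 0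

/-- `P` is a lattice of rank `k` in `T*B`: near every point it is the integral span of `k` smooth
`1`-forms that are linearly independent at each point. -/
def IsLattice (k : ℕ) (P : ∀ x : B, AddSubgroup (Cot n x)) : Prop :=
  ∀ x₀ : B, ∃ U : Set B, IsOpen U ∧ x₀ ∈ U ∧ ∃ α : Fin k → ∀ x : B, Cot n x,
    (∀ i, SmoothFormOn (α i) U) ∧
    ∀ x ∈ U, LinearIndependent ℝ (fun i => α i x) ∧
      P x = AddSubgroup.closure (range fun i => α i x)

/-- `P` is a closed lattice of rank `k`: a lattice all of whose local smooth sections are closed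
`1`-forms. -/
structure IsClosedLattice (k : ℕ) (P : ∀ x : B, AddSubgroup (Cot n x)) : Prop where
  isLattice : IsLattice k P
  closed : ∀ U : Set B, IsOpen U → ∀ α : ∀ x : B, Cot n x, SmoothFormOn α U →
    (∀ x ∈ U, α x ∈ P x) → ClosedFormOn α U

end Lattice

/-! ### Affine fibrations with underlying fibration `T*B/P` -/

section Affine

variable {n : ℕ} {B : Type*} [TopologicalSpace B] [ChartedSpace (EuclideanSpace ℝ (Fin n)) B]
  [IsManifold (𝓡 n) ∞ B]

/-- An affine fibration `π : E → B` with underlying fibration `T*B/P → B`: each group `T*ₓB/Pₓ`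
acts freely and transitively on the fibre `Eₓ = π⁻¹(x)`, and over a neighbourhood `U` of every
point there is an equivariant fibrewise diffeomorphism of `(T*B/P)|_U` onto `π⁻¹(U)`.

The latter is given by its composite `Φ : T*U → π⁻¹(U)` with the covering `T*U → T*U/P`. Since
the action is free and transitive, `Φ` induces a bijection `T*U/P → π⁻¹(U)`; since `T*B/P` has
the smooth structure for which `T*B → T*B/P` is a local diffeomorphism, this bijection is a
diffeomorphism if and only if `Φ` is a local diffeomorphism. -/
structure AffineFibration (P : ∀ x : B, AddSubgroup (Cot n x)) (E : Type*) [TopologicalSpace E]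
    [ChartedSpace (EuclideanSpace ℝ (Fin (2 * n))) E] where
  /-- the projection `π` -/
  proj : E → B
  /-- the action of `T*ₓB/Pₓ` on the fibre over `x` -/
  action : ∀ x : B, AddAction (Cot n x ⧸ P x) (proj ⁻¹' {x})
  /-- the action on each fibre is free and transitive -/
  regular : ∀ (x : B) (z w : proj ⁻¹' {x}), ∃! a : Cot n x ⧸ P x, a +ᵥ z = w
  /-- smooth local triviality -/
  locallyTrivial : ∀ x₀ : B, ∃ U : Set B, IsOpen U ∧ x₀ ∈ U ∧ ∃ Φ : CotBundle n B → E,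
    ∃ hΦ : ∀ x ∈ U, ∀ v : Cot n x, Φ (cotPt v) ∈ proj ⁻¹' {x},
      (∀ (x : B) (hx : x ∈ U) (v w : Cot n x),
        ((QuotientAddGroup.mk v : Cot n x ⧸ P x) +ᵥ
          (⟨Φ (cotPt w), hΦ x hx w⟩ : proj ⁻¹' {x})) = ⟨Φ (cotPt (v + w)), hΦ x hx (v + w)⟩) ∧
      IsLocalDiffeomorphOn (cotI n) (𝓡 (2 * n)) ∞ Φ {ξ | ξ.proj ∈ U}

namespace AffineFibration

variable {P : ∀ x : B, AddSubgroup (Cot n x)}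
  {E : Type*} [TopologicalSpace E] [ChartedSpace (EuclideanSpace ℝ (Fin (2 * n))) E]
  {E' : Type*} [TopologicalSpace E'] [ChartedSpace (EuclideanSpace ℝ (Fin (2 * n))) E']

/-- The fibre of `π : E → B` over `x`. -/
abbrev Fiber (A : AffineFibration P E) (x : B) : Type _ := A.proj ⁻¹' {x}

instance (A : AffineFibration P E) (x : B) : AddAction (Cot n x ⧸ P x) (A.Fiber x) := A.action x

/-- The point `v ∘ z`, for a covector `v` at `x` and a point `z` of the fibre over `x`. -/
def shift (A : AffineFibration P E) {x : B} (v : Cot n x) (z : E) (hz : A.proj z = x) : E :=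
  ((QuotientAddGroup.mk v : Cot n x ⧸ P x) +ᵥ (⟨z, hz⟩ : A.Fiber x)).1

/-- Two affine fibrations with underlying fibration `T*B/P` are equivalent: there is a
diffeomorphism of the total spaces that maps each fibre to the fibre over the same point and
preserves the action. -/
def Equivalent (A : AffineFibration P E) (A' : AffineFibration P E') : Prop :=
  ∃ f : E ≃ₘ⟮𝓡 (2 * n), 𝓡 (2 * n)⟯ E', ∃ hf : ∀ x : B, ∀ z : A.Fiber x, f z.1 ∈ A'.proj ⁻¹' {x},
    ∀ (x : B) (a : Cot n x ⧸ P x) (z : A.Fiber x),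
      f (a +ᵥ z).1 = (a +ᵥ (⟨f z.1, hf x z⟩ : A'.Fiber x)).1

end AffineFibration

end Affine

/-! ### Cohomology of `B` with local coefficients in `P` -/

section Cohomology

variable {n : ℕ} {B : Type*} [TopologicalSpace B] [ChartedSpace (EuclideanSpace ℝ (Fin n)) B]
  [IsManifold (𝓡 n) ∞ B]

/-- The standard (geometric) `k`-simplex. -/
abbrev Simplex (k : ℕ) : Type := stdSimplex ℝ (Fin (k + 1))

/-- The `i`-th face `Δᵏ → Δᵏ⁺¹` (opposite to the `i`-th vertex). -/
def face {k : ℕ} (i : Fin (k + 2)) : C(Simplex k, Simplex (k + 1)) :=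
  ⟨stdSimplex.map i.succAbove, stdSimplex.continuous_map _⟩

/-- The `i`-th vertex of the standard `k`-simplex. -/
def vertex {k : ℕ} (i : Fin (k + 1)) : Simplex k := stdSimplex.vertex i

/-- The fibrewise difference of continuous lifts to the cotangent bundle is continuous. -/
theorem continuous_sub_lift {X : Type*} [TopologicalSpace X] {f : X → B}
    {p q : ∀ t : X, Cot n (f t)} (hp : Continuous fun t => cotPt (p t))
    (hq : Continuous fun t => cotPt (q t)) : Continuous fun t => cotPt (p t - q t) := by
  rw [continuous_iff_continuousAt] at hp hq ⊢
  intro t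
  have hp' := hp t
  have hq' := hq t
  rw [FiberBundle.continuousAt_totalSpace] at hp' hq' ⊢
  refine ⟨hp'.1, (hp'.2.sub hq'.2).congr ?_⟩
  have hf : ContinuousAt f t := hp'.1
  filter_upwards [hf.eventually ((trivializationAt (CotModel n) (fun x : B => Cot n x)
    (f t)).open_baseSet.mem_nhds (mem_baseSet_trivializationAt _ _ _))] with u hu
  exact (((trivializationAt (CotModel n) (fun x : B => Cot n x) (f t)).linear ℝ hu).mk'.map_sub
    (p u) (q u)).symm

theorem continuous_zero_lift {X : Type*} [TopologicalSpace X] (f : C(X, B)) :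
    Continuous fun t => cotPt (0 : Cot n (f t)) :=
  (contMDiff_zeroSection ℝ (fun x : B => Cot n x) (IB := 𝓡 n) (n := 0)).continuous.comp
    f.continuous

/-- The group `Γ(X, f*P)` of continuous sections of `P` along a map `f : X → B`. -/
def Sections (P : ∀ x : B, AddSubgroup (Cot n x)) {X : Type*} [TopologicalSpace X] (f : C(X, B)) :
    AddSubgroup (∀ t : X, Cot n (f t)) :=
  AddSubgroup.ofSub {p | (∀ t, p t ∈ P (f t)) ∧ Continuous fun t => cotPt (p t)}
    ⟨0, fun t => (P (f t)).zero_mem, continuous_zero_lift f⟩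
    (fun p hp q hq => by
      refine ⟨fun t => ?_, ?_⟩
      · simpa [sub_eq_add_neg] using (P (f t)).sub_mem (hp.1 t) (hq.1 t)
      · simpa [sub_eq_add_neg] using continuous_sub_lift hp.2 hq.2)

/-- Restriction (pullback) of sections along `g : Y → X`. -/
def restrict {P : ∀ x : B, AddSubgroup (Cot n x)} {X Y : Type*} [TopologicalSpace X]
    [TopologicalSpace Y] {f : C(X, B)} (p : Sections P f) (g : C(Y, X)) : Sections P (f.comp g) :=
  ⟨fun t => p.1 (g t), fun t => p.2.1 (g t), p.2.2.comp g.continuous⟩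

/-- Singular `k`-cochains of `B` with coefficients in the system of local coefficients `P`: a
cochain assigns to each singular simplex `σ : Δᵏ → B` a section of `P` along `σ` (equivalently,
an element of the group `P` at the leading vertex of `σ`). -/
abbrev Cochain (P : ∀ x : B, AddSubgroup (Cot n x)) (k : ℕ) : Type _ :=
  ∀ σ : C(Simplex k, B), Sections P σ

/-- `d = δc`: for each singular `(k+1)`-simplex `σ`, `d σ = ∑ᵢ (-1)ⁱ qᵢ`, where `qᵢ` is the
section of `P` along `σ` that extends the section `c (σ ∘ ∂ᵢ)` given along the `i`-th face. For a
lattice `P` the extensions `qᵢ` exist and are unique, since simplices are simply connected. -/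
def IsCoboundary {P : ∀ x : B, AddSubgroup (Cot n x)} {k : ℕ} (c : Cochain P k)
    (d : Cochain P (k + 1)) : Prop :=
  ∀ σ : C(Simplex (k + 1), B), ∃ q : Fin (k + 2) → Sections P σ,
    (∀ i, restrict (q i) (face i) = c (σ.comp (face i))) ∧
    d σ = ∑ i : Fin (k + 2), ((-1 : ℤ) ^ (i : ℕ)) • q i

theorem IsCoboundary.sub {P : ∀ x : B, AddSubgroup (Cot n x)} {k : ℕ} {c c' : Cochain P k}
    {d d' : Cochain P (k + 1)} (h : IsCoboundary c d) (h' : IsCoboundary c' d') :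
    IsCoboundary (c - c') (d - d') := by
  intro σ
  obtain ⟨q, hq, hd⟩ := h σ
  obtain ⟨q', hq', hd'⟩ := h' σ
  refine ⟨q - q', fun i => ?_, ?_⟩
  · rw [Pi.sub_apply c, ← hq, ← hq']
    rfl
  · rw [Pi.sub_apply, hd, hd', ← Finset.sum_sub_distrib]
    exact Finset.sum_congr rfl fun i _ => (zsmul_sub _ _ _).symm

theorem IsCoboundary.zero {P : ∀ x : B, AddSubgroup (Cot n x)} {k : ℕ} :
    IsCoboundary (0 : Cochain P k) 0 :=
  fun σ => ⟨0, fun _ => rfl, by simp⟩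

/-- The group `Zᵏ(B, P)` of cocycles. -/
def Cocycles (P : ∀ x : B, AddSubgroup (Cot n x)) (k : ℕ) : AddSubgroup (Cochain P k) :=
  AddSubgroup.ofSub {c | IsCoboundary c 0} ⟨0, IsCoboundary.zero⟩
    (fun c hc d hd => by simpa [sub_eq_add_neg] using IsCoboundary.sub hc hd)

/-- The group `Bᵏ⁺¹(B, P)` of coboundaries. -/
def Coboundaries (P : ∀ x : B, AddSubgroup (Cot n x)) (k : ℕ) :
    AddSubgroup (Cochain P (k + 1)) :=
  AddSubgroup.ofSub {d | ∃ c, IsCoboundary c d} ⟨0, 0, IsCoboundary.zero⟩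
    (fun d hd d' hd' => by
      obtain ⟨c, hc⟩ := hd
      obtain ⟨c', hc'⟩ := hd'
      exact ⟨c - c', by simpa [sub_eq_add_neg] using IsCoboundary.sub hc hc'⟩)

/-- The second cohomology group `H²(B, P) = Z²(B, P) / B²(B, P)` of `B` with coefficients in the
system of local coefficients `P`. -/
abbrev H2 (P : ∀ x : B, AddSubgroup (Cot n x)) : Type _ :=
  Cocycles P 2 ⧸ (Coboundaries P 1).addSubgroupOf (Cocycles P 2)

end Cohomology

/-! ### Primary obstruction classes -/

section Obstruction

variable {n : ℕ} {B : Type*} [TopologicalSpace B] [ChartedSpace (EuclideanSpace ℝ (Fin n)) B]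
  [IsManifold (𝓡 n) ∞ B] {P : ∀ x : B, AddSubgroup (Cot n x)}
  {E : Type*} [TopologicalSpace E] [ChartedSpace (EuclideanSpace ℝ (Fin (2 * n))) E]

/-- A section of `π : E → B` over the `1`-skeleton of the complex of singular simplices of `B`:
a point `pt x` of the fibre over each `x`, and for each singular `1`-simplex `γ` a continuous lift
of `γ` to `E` with endpoints `pt (γ 0)` and `pt (γ 1)`. -/
structure SectionOnOneSkeleton (A : AffineFibration P E) where
  /-- the section over the `0`-simplices -/
  pt : B → E
  proj_pt : ∀ x, A.proj (pt x) = x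
  /-- the section over the `1`-simplices -/
  edge : C(Simplex 1, B) → C(Simplex 1, E)
  proj_edge : ∀ γ u, A.proj (edge γ u) = γ u
  edge_vertex : ∀ γ i, edge γ (vertex i) = pt (γ (vertex i))

/-- `c` is the obstruction cochain of the section `s` over the `1`-skeleton: `c σ` is the element
of the fundamental group `π₁(T*B/P) = P` of the fibre over the `2`-simplex `σ` that is
represented by the restriction of `s` to the boundary of `σ`, in a trivialization of `E` along
`σ`.

In detail, let `v₀, v₁, v₂` be the vertices of `Δ²`. A section `t` of `E` along `σ` identifies
`σ*E` with `σ*(T*B/P)`, and `s` along the boundary loop `v₀ → v₁ → v₂ → v₀` with a loop `[ξ]` in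
`T*B/P`, `s = ξ ∘ t`. Lift it to a path `ξ` in `T*B`, which is `ξ 2` on the edge from `v₀` to
`v₁`, then `ξ 0` on the edge from `v₁` to `v₂`, then `ξ 1` backwards on the edge from `v₀` to
`v₂`. The value of `c σ` at `v₀` is the end of `ξ` minus its start. -/
def IsObstructionCochain {A : AffineFibration P E} (s : SectionOnOneSkeleton A)
    (c : Cochain P 2) : Prop :=
  ∀ σ : C(Simplex 2, B), ∃ t : C(Simplex 2, E), ∃ ht : ∀ y, A.proj (t y) = σ y,
    ∃ ξ : ∀ (i : Fin 3) (u : Simplex 1), Cot n (σ (face i u)),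
      (∀ i, Continuous fun u => cotPt (ξ i u)) ∧
      (∀ i u, s.edge (σ.comp (face i)) u = A.shift (ξ i u) (t (face i u)) (ht (face i u))) ∧
      cotPt (ξ 2 (vertex 1)) = cotPt (ξ 0 (vertex 0)) ∧
      cotPt (ξ 0 (vertex 1)) = cotPt (ξ 1 (vertex 1)) ∧
      cotPt (ξ 1 (vertex 0)) =
        cotPt (ξ 2 (vertex 0) + (c σ).1 (face 2 (vertex 0)))

/-- `γ ∈ H²(B, P)` is a primary obstruction class of the affine fibration `A`: it is the class of
the obstruction cochain of a section over the `1`-skeleton. -/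
def AffineFibration.IsPrimaryObstructionClass (A : AffineFibration P E) (γ : H2 P) : Prop :=
  ∃ (s : SectionOnOneSkeleton A) (c : Cocycles P 2), IsObstructionCochain s c.1 ∧
    γ = QuotientAddGroup.mk c

end Obstruction

end LatticeFibration

end

open LatticeFibration

set_option linter.unusedSectionVars false

namespace LatticeFibration

/-! ### Covector fields along maps and their continuity in coordinates -/

section CotangentLifts

variable {n : ℕ} {B : Type*} [TopologicalSpace B] [ChartedSpace (EuclideanSpace ℝ (Fin n)) B]
  [IsManifold (𝓡 n) ∞ B] {X : Type*} [TopologicalSpace X]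

/-! This is obstruction theory made explicit. Over a simplex nothing is twisted: `E` has a
continuous section and elements of `P` continue uniquely. Relative to a section of `E` over a space
`X` without monodromy, a section over the 1-skeleton becomes a family of base covectors `b` and a
holonomy `G e`, a section of `P` over all of `X`, for each path `e`. Its obstruction cochain is then
`G ∂₀ - G ∂₁ + G ∂₂` (`IsHolonomy.obstruction_eq`). Over `Δ³` every edge occurs twice with opposite
signs, so this is a cocycle; another section over the 1-skeleton changes `G` by a 1-cochain and the
obstruction by its coboundary. So the class exists and is unique, and an equivalence transports it.

Conversely, let `c - c' = δε`. Over a star-shaped set, `D = G - G' - ε` is a closed 1-cochain with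
values in one abelian group, hence the coboundary of its values on the paths from the centre.
Subtracting this primitive from `b' - b` gives a covector field `v`, the difference of the two
1-skeleton sections relative to smooth local sections (`exists_isPotential`). The field `v` need not
be continuous, but two such fields differ by a smooth form, because up to the smooth differences of
the local sections their difference is a section of `P` (`IsLocalPotential.contMDiffAt_sub`).

With a partition of unity put `H = ∑ ρᵢ vᵢ`; then `vⱼ - H = ∑ ρᵢ (vⱼ - vᵢ)` is smooth. The
equivariant map taking each chosen point of the first fibration to that of the second shifted by
`-H` is, in local trivializations, addition of `vⱼ - H`, hence an equivalence
(`Compatible.equivalent`). In sheaf terms, the sheaf of 1-forms is fine, so smooth `T*B/P`-torsors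
are classified by `H²(B, P)`. -/

/-- The preferred trivialization of the cotangent bundle at `b`. -/
noncomputable abbrev cotTriv (b : B) :
    Trivialization (CotModel n) (π (CotModel n) (fun x : B => Cot n x)) :=
  trivializationAt (CotModel n) (fun x : B => Cot n x) b

/-- Coordinates of covectors at `x` in the trivialization at `b`. -/
noncomputable def cotCoord (b x : B) : Cot n x →ₗ[ℝ] CotModel n := (cotTriv b).linearMapAt ℝ x

/-- The covector at `x` with given coordinates in the trivialization at `b`. -/
noncomputable def cotOfCoord (b x : B) : CotModel n →ₗ[ℝ] Cot n x := (cotTriv b).symmₗ ℝ x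

theorem mem_cotTriv_self (b : B) : b ∈ (cotTriv (n := n) b).baseSet :=
  mem_baseSet_trivializationAt _ _ _

theorem cotTriv_mem_nhds {b x : B} (hx : x ∈ (cotTriv (n := n) b).baseSet) :
    (cotTriv (n := n) b).baseSet ∈ 𝓝 x :=
  (cotTriv (n := n) b).open_baseSet.mem_nhds hx

theorem cotCoord_apply {b x : B} (hx : x ∈ (cotTriv (n := n) b).baseSet) (v : Cot n x) :
    cotCoord b x v = ((cotTriv b) (cotPt v)).2 := by
  rw [cotCoord, Trivialization.coe_linearMapAt_of_mem _ hx]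

theorem cotCoord_cotOfCoord {b x : B} (hx : x ∈ (cotTriv (n := n) b).baseSet) (w : CotModel n) :
    cotCoord b x (cotOfCoord b x w) = w :=
  Trivialization.linearMapAt_symmₗ _ hx w

theorem cotOfCoord_cotCoord {b x : B} (hx : x ∈ (cotTriv (n := n) b).baseSet) (v : Cot n x) :
    cotOfCoord b x (cotCoord b x v) = v :=
  Trivialization.symmₗ_linearMapAt _ hx v

theorem cotCoord_injective {b x : B} (hx : x ∈ (cotTriv (n := n) b).baseSet) :
    Function.Injective (cotCoord (n := n) b x) :=
  Function.LeftInverse.injective (cotOfCoord_cotCoord hx)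

/-- The trivialization at one fixed `b` turns a covector field along `f` into a map to a fixed
vector space, where sums and differences can be handled. -/
theorem continuousWithinAt_cotPt_iff {f : X → B} {p : ∀ y : X, Cot n (f y)} {K : Set X} {y₀ : X}
    {b : B} (hf : ContinuousWithinAt f K y₀) (hb : f y₀ ∈ (cotTriv (n := n) b).baseSet) :
    ContinuousWithinAt (fun y => cotPt (p y)) K y₀ ↔
      ContinuousWithinAt (fun y => cotCoord b (f y) (p y)) K y₀ := by
  have hsrc : cotPt (p y₀) ∈ (cotTriv (n := n) b).source :=
    (cotTriv (n := n) b).mem_source.2 hb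
  have key := (cotTriv (n := n) b).tendsto_nhds_iff (l := 𝓝[K] y₀) (f := fun y => cotPt (p y)) hsrc
  unfold ContinuousWithinAt
  rw [key]
  refine (and_iff_right hf).trans ?_
  beta_reduce
  rw [cotCoord_apply hb]
  apply Filter.tendsto_congr'
  filter_upwards [hf (cotTriv_mem_nhds hb)] with y hy
  exact (cotCoord_apply hy _).symm

theorem continuousWithinAt_cotPt_base {f : X → B} {p : ∀ y : X, Cot n (f y)} {K : Set X} {y₀ : X}
    (hp : ContinuousWithinAt (fun y => cotPt (p y)) K y₀) : ContinuousWithinAt f K y₀ :=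
  (FiberBundle.continuous_proj (CotModel n) (fun x : B => Cot n x)).continuousAt.comp_continuousWithinAt hp

theorem continuousWithinAt_add {f : X → B} {p q : ∀ y : X, Cot n (f y)} {K : Set X} {y₀ : X}
    (hp : ContinuousWithinAt (fun y => cotPt (p y)) K y₀)
    (hq : ContinuousWithinAt (fun y => cotPt (q y)) K y₀) :
    ContinuousWithinAt (fun y => cotPt (p y + q y)) K y₀ := by
  have hf := continuousWithinAt_cotPt_base hp
  rw [continuousWithinAt_cotPt_iff hf (mem_cotTriv_self _)] at hp hq ⊢
  simp only [map_add]
  exact hp.add hq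

theorem continuousOn_add {f : X → B} {p q : ∀ y : X, Cot n (f y)} {K : Set X}
    (hp : ContinuousOn (fun y => cotPt (p y)) K) (hq : ContinuousOn (fun y => cotPt (q y)) K) :
    ContinuousOn (fun y => cotPt (p y + q y)) K :=
  fun y hy => continuousWithinAt_add (hp y hy) (hq y hy)

theorem continuousOn_neg {f : X → B} {p : ∀ y : X, Cot n (f y)} {K : Set X}
    (hp : ContinuousOn (fun y => cotPt (p y)) K) : ContinuousOn (fun y => cotPt (-p y)) K :=
  fun y hy => by
    have hf := continuousWithinAt_cotPt_base (hp y hy)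
    have h := (continuousWithinAt_cotPt_iff hf (mem_cotTriv_self _)).1 (hp y hy)
    rw [continuousWithinAt_cotPt_iff hf (mem_cotTriv_self _)]
    simp only [map_neg]
    exact h.neg

theorem continuousOn_sub {f : X → B} {p q : ∀ y : X, Cot n (f y)} {K : Set X}
    (hp : ContinuousOn (fun y => cotPt (p y)) K) (hq : ContinuousOn (fun y => cotPt (q y)) K) :
    ContinuousOn (fun y => cotPt (p y - q y)) K := by
  simpa only [sub_eq_add_neg] using continuousOn_add hp (continuousOn_neg hq)

theorem continuousOn_zero {f : X → B} {K : Set X} (hf : ContinuousOn f K) :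
    ContinuousOn (fun y => cotPt (0 : Cot n (f y))) K := fun y hy => by
  rw [continuousWithinAt_cotPt_iff (hf y hy) (mem_cotTriv_self _)]
  simpa only [map_zero] using continuousWithinAt_const

theorem continuous_add {f : X → B} {p q : ∀ y : X, Cot n (f y)}
    (hp : Continuous (fun y => cotPt (p y))) (hq : Continuous (fun y => cotPt (q y))) :
    Continuous (fun y => cotPt (p y + q y)) := by
  rw [← continuousOn_univ] at *
  exact continuousOn_add hp hq

/-- A map to the cotangent bundle is a covector field along its projection. -/
theorem exists_cotPt_eq {f : X → B} (g : X → CotBundle n B) :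
    ∃ p : ∀ y : X, Cot n (f y), ∀ y, (g y).proj = f y → cotPt (p y) = g y := by
  have : ∀ y, ∃ v : Cot n (f y), (g y).proj = f y → cotPt v = g y := by
    intro y
    by_cases h : (g y).proj = f y
    · generalize f y = x at h
      subst h
      exact ⟨(g y).2, fun _ => rfl⟩
    · exact ⟨0, fun h' => absurd h' h⟩
  choose p hp using this
  exact ⟨p, hp⟩

/-- Covectors at points that are equal only propositionally have different types; in the total space
they can be compared. -/
theorem cotPt_congr {f : X → B} (p : ∀ y : X, Cot n (f y)) {y y' : X} (h : y = y') :
    cotPt (p y) = cotPt (p y') := by rw [h]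

theorem eq_of_cotPt_eq {x : B} {v w : Cot n x} (h : cotPt v = cotPt w) : v = w := by
  simpa using h

end CotangentLifts

/-! ### Discreteness of the lattice and unique continuation -/

section Lattice

variable {n k : ℕ} {B : Type*} [TopologicalSpace B] [ChartedSpace (EuclideanSpace ℝ (Fin n)) B]
  [IsManifold (𝓡 n) ∞ B] {X : Type*} [TopologicalSpace X] {P : ∀ x : B, AddSubgroup (Cot n x)}

/-- Small perturbations of linearly independent vectors have no small nontrivial integral
combinations. -/
theorem exists_nhds_integral_combination_eq_zero {F : Type*} [NormedAddCommGroup F]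
    [NormedSpace ℝ F] {a : Fin k → F} (ha : LinearIndependent ℝ a) :
    ∃ ε > 0, ∀ a' : Fin k → F, (∀ i, ‖a' i - a i‖ < ε) →
      ∀ m : Fin k → ℤ, ‖∑ i, m i • a' i‖ < ε → m = 0 := by
  let L : (Fin k → ℝ) →ₗ[ℝ] F := Fintype.linearCombination ℝ a
  have hL : LinearMap.ker L = ⊥ := by
    rw [LinearMap.ker_eq_bot]
    exact ha.fintypeLinearCombination_injective
  obtain ⟨c, hc, hcL⟩ := L.exists_antilipschitzWith hL
  have hc' : (0 : ℝ) < c := hc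
  have hLb : ∀ r, ‖r‖ ≤ c * ‖L r‖ := fun r => by
    simpa using hcL.le_mul_dist r 0
  -- The constant is chosen so that `c (k + 1) ε = 1 - ε`. For `m ≠ 0` the coefficient vector has
  -- sup norm at least 1, and the estimates then give `‖r‖ ≤ (1 - ε) ‖r‖`.
  refine ⟨1 / (c * (k + 1) + 1), by positivity, fun a' ha' m hm => ?_⟩
  by_contra hm0
  set ε : ℝ := 1 / (c * (k + 1) + 1)
  have hε : 0 < ε := by positivity
  set r : Fin k → ℝ := fun i => (m i : ℝ)
  have hr1 : 1 ≤ ‖r‖ := by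
    obtain ⟨i, hi⟩ := Function.ne_iff.1 hm0
    refine le_trans ?_ (norm_le_pi_norm r i)
    have : (1 : ℤ) ≤ |m i| := Int.one_le_abs hi
    simp only [r, Real.norm_eq_abs]
    exact_mod_cast this
  have hLr : L r = ∑ i, m i • a' i - ∑ i, (m i : ℝ) • (a' i - a i) := by
    simp only [L, Fintype.linearCombination_apply, r, ← Int.cast_smul_eq_zsmul ℝ, smul_sub,
      Finset.sum_sub_distrib]
    abel
  have h2 : ‖∑ i, (m i : ℝ) • (a' i - a i)‖ ≤ k * (‖r‖ * ε) := by
    refine (norm_sum_le _ _).trans ?_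
    calc ∑ i, ‖(m i : ℝ) • (a' i - a i)‖ ≤ ∑ _i : Fin k, ‖r‖ * ε := by
          refine Finset.sum_le_sum fun i _ => ?_
          rw [norm_smul]
          exact mul_le_mul (norm_le_pi_norm r i) (ha' i).le (norm_nonneg _) (norm_nonneg _)
      _ = k * (‖r‖ * ε) := by simp
  have h3 : ‖L r‖ ≤ ε + k * (‖r‖ * ε) := by
    rw [hLr]
    exact (norm_sub_le _ _).trans (add_le_add hm.le h2)
  have h4 : ε * (c * (k + 1) + 1) = 1 := by
    simp only [ε]; field_simp
  have h5 := hLb r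
  have h6 : c * ‖L r‖ ≤ c * (‖r‖ * ε + k * (‖r‖ * ε)) := by
    refine mul_le_mul_of_nonneg_left (h3.trans ?_) hc'.le
    have : ε ≤ ‖r‖ * ε := le_mul_of_one_le_left hε.le hr1
    linarith
  have h7 : c * (‖r‖ * ε + k * (‖r‖ * ε)) = ‖r‖ * (1 - ε) := by
    linear_combination ‖r‖ * h4
  have h8 : ‖r‖ * ε ≤ 0 := by nlinarith
  nlinarith

/-- Discreteness, uniform near `f y₀`: the coordinates of `p y` are small, and a small integral
combination of a perturbed independent family has zero coefficients. -/
theorem IsLattice.eventually_eq_zero (hP : IsLattice k P) {f : X → B} {p : ∀ y, Cot n (f y)}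
    {K : Set X} {y₀ : X} (hc : ContinuousWithinAt (fun y => cotPt (p y)) K y₀)
    (hp : ∀ y ∈ K, p y ∈ P (f y)) (h0 : p y₀ = 0) : ∀ᶠ y in 𝓝[K] y₀, p y = 0 := by
  obtain ⟨U, hU, hxU, α, hα, hspan⟩ := hP (f y₀)
  have hf := continuousWithinAt_cotPt_base hc
  set b := f y₀ with hb
  have hbU : U ∈ 𝓝 b := hU.mem_nhds hxU
  have hαc : ∀ i, ContinuousAt (fun x => cotCoord b x (α i x)) b := fun i => by
    have := ((hα i).continuousOn b hxU)
    rw [continuousWithinAt_cotPt_iff (f := id) continuousWithinAt_id (mem_cotTriv_self b)] at this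
    exact this.continuousAt hbU
  have hli : LinearIndependent ℝ (fun i => cotCoord b b (α i b)) :=
    ((hspan b hxU).1).map' (cotCoord b b) (LinearMap.ker_eq_bot.2
      (cotCoord_injective (mem_cotTriv_self b)))
  obtain ⟨ε, hε, H⟩ := exists_nhds_integral_combination_eq_zero hli
  have e1 : ∀ᶠ x in 𝓝 b, ∀ i, ‖cotCoord b x (α i x) - cotCoord b b (α i b)‖ < ε := by
    rw [Filter.eventually_all]
    intro i
    have := (hαc i).eventually (Metric.ball_mem_nhds _ hε)
    simpa [dist_eq_norm] using this
  have hpc : ContinuousWithinAt (fun y => cotCoord b (f y) (p y)) K y₀ :=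
    (continuousWithinAt_cotPt_iff hf (mem_cotTriv_self _)).1 hc
  have e2 : ∀ᶠ y in 𝓝[K] y₀, ‖cotCoord b (f y) (p y)‖ < ε := by
    have := hpc.eventually (Metric.ball_mem_nhds _ hε)
    simpa [dist_eq_norm, h0] using this
  filter_upwards [hf.eventually e1, e2, hf.eventually hbU,
    hf.eventually (cotTriv_mem_nhds (mem_cotTriv_self (n := n) b)), self_mem_nhdsWithin] with y h1 h2 h3 h4 h5
  have hmem := hp y h5
  rw [(hspan _ h3).2, ← Submodule.span_int_eq_addSubgroupClosure, Submodule.mem_toAddSubgroup,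
    Submodule.mem_span_range_iff_exists_fun] at hmem
  obtain ⟨m, hm⟩ := hmem
  have : m = 0 := by
    refine H (fun i => cotCoord b (f y) (α i (f y))) h1 m ?_
    have : ∑ i, m i • cotCoord b (f y) (α i (f y)) = cotCoord b (f y) (p y) := by
      rw [← hm, map_sum]
      simp only [map_zsmul]
    rwa [this]
  rw [← hm, this]
  simp

/-- Agreement is open in `K` by discreteness of the lattice, disagreement by continuity. -/
theorem IsLattice.eqOn_of_isPreconnected (hP : IsLattice k P) {f : X → B} {p q : ∀ y, Cot n (f y)}
    {K : Set X} (hK : IsPreconnected K) (hp : ContinuousOn (fun y => cotPt (p y)) K)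
    (hq : ContinuousOn (fun y => cotPt (q y)) K) (hpP : ∀ y ∈ K, p y ∈ P (f y))
    (hqP : ∀ y ∈ K, q y ∈ P (f y)) {y₀ : X} (hy₀ : y₀ ∈ K) (h : p y₀ = q y₀) :
    ∀ y ∈ K, p y = q y := by
  have hd := continuousOn_sub hp hq
  have hdP : ∀ y ∈ K, p y - q y ∈ P (f y) := fun y hy => (P _).sub_mem (hpP y hy) (hqP y hy)
  have hloc : ∀ y ∈ K, p y - q y = 0 → ∀ᶠ z in 𝓝[K] y, p z - q z = 0 := fun y hy h0 =>
    hP.eventually_eq_zero (hd y hy) hdP h0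
  have hne : ∀ y ∈ K, p y - q y ≠ 0 → ∀ᶠ z in 𝓝[K] y, p z - q z ≠ 0 := by
    intro y hy h0
    have hf := continuousWithinAt_cotPt_base (hd y hy)
    have h1 := (continuousWithinAt_cotPt_iff hf (mem_cotTriv_self _)).1 (hd y hy)
    have h2 : cotCoord (f y) (f y) (p y - q y) ≠ 0 := by
      intro h3
      exact h0 (cotCoord_injective (mem_cotTriv_self _) (by rw [h3, map_zero]))
    filter_upwards [h1.eventually_ne h2] with z hz h3
    exact hz (by rw [h3, map_zero])
  have H := fun y (hy : y ∈ K) => hK.induction₂' (P := fun a b => (p a - q a = 0 ↔ p b - q b = 0)) (fun y hy => by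
    by_cases h0 : p y - q y = 0
    · filter_upwards [hloc y hy h0] with z hz
      simp [h0, hz]
    · filter_upwards [hne y hy h0] with z hz
      simp [h0, hz]) (fun a b c _ _ _ h1 h2 => h1.trans h2) hy₀ hy
  intro y hy
  exact sub_eq_zero.1 ((H y hy).1 (sub_eq_zero.2 h))

/-- Near every point, every element of the lattice extends to a smooth section. -/
theorem IsLattice.exists_local_sections (hP : IsLattice k P) (x₀ : B) :
    ∃ U : Set B, IsOpen U ∧ x₀ ∈ U ∧ ∀ x ∈ U, ∀ p ∈ P x, ∃ q : ∀ y : B, Cot n y,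
      SmoothFormOn q U ∧ (∀ y ∈ U, q y ∈ P y) ∧ q x = p := by
  obtain ⟨U, hU, hxU, α, hα, hspan⟩ := hP x₀
  refine ⟨U, hU, hxU, fun x hx p hp => ?_⟩
  rw [(hspan _ hx).2, ← Submodule.span_int_eq_addSubgroupClosure, Submodule.mem_toAddSubgroup,
    Submodule.mem_span_range_iff_exists_fun] at hp
  obtain ⟨m, hm⟩ := hp
  -- The integers expressing `p` at `x` are kept fixed as the point varies.
  refine ⟨fun y => ∑ i, (m i : ℝ) • α i y, ?_, fun y hy => ?_, ?_⟩
  · exact ContMDiffOn.sum_section fun i _ => ContMDiffOn.const_smul_section (hα i)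
  · refine (P y).sum_mem fun i _ => ?_
    rw [Int.cast_smul_eq_zsmul ℝ (m i) (α i y)]
    refine (P y).zsmul_mem ?_ _
    rw [(hspan _ hy).2]
    exact AddSubgroup.subset_closure ⟨i, rfl⟩
  · rw [← hm]
    exact Finset.sum_congr rfl fun i _ => Int.cast_smul_eq_zsmul ℝ (m i) (α i x)

end Lattice

end LatticeFibration

namespace LatticeFibration

/-! ### From local to global on a simplex by cubical subdivision -/

section SimplexInduction

variable {m : ℕ}

/-- Closed convex subsets of the standard simplex. -/
def ClosedConvex (K : Set (Simplex m)) : Prop :=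
  ∃ C : Set (Fin (m + 1) → ℝ), IsClosed C ∧ Convex ℝ C ∧ K = Subtype.val ⁻¹' C

theorem ClosedConvex.isClosed {K : Set (Simplex m)} (h : ClosedConvex K) : IsClosed K := by
  obtain ⟨C, hC, _, rfl⟩ := h
  exact hC.preimage continuous_subtype_val

theorem ClosedConvex.inter {K L : Set (Simplex m)} (hK : ClosedConvex K) (hL : ClosedConvex L) :
    ClosedConvex (K ∩ L) := by
  obtain ⟨C, hC, hC', rfl⟩ := hK
  obtain ⟨D, hD, hD', rfl⟩ := hL
  exact ⟨C ∩ D, hC.inter hD, hC'.inter hD', rfl⟩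

theorem ClosedConvex.isPreconnected {K : Set (Simplex m)} (h : ClosedConvex K) :
    IsPreconnected K := by
  obtain ⟨C, _, hC, rfl⟩ := h
  rw [← Topology.IsInducing.subtypeVal.isPreconnected_image, Subtype.image_preimage_coe]
  exact ((convex_stdSimplex ℝ _).inter hC).isPreconnected

theorem closedConvex_univ : ClosedConvex (univ : Set (Simplex m)) :=
  ⟨univ, isClosed_univ, convex_univ, rfl⟩

instance : Nonempty (Simplex m) := ⟨vertex 0⟩

instance : PreconnectedSpace (Simplex m) := ⟨closedConvex_univ.isPreconnected⟩

/-- The cells of the cubical subdivision of mesh `1 / N`, with the first `j` coordinates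
constrained. -/
def gridCell (N j : ℕ) (c : Fin (m + 1) → ℕ) : Set (Simplex m) :=
  {y | ∀ i : Fin (m + 1), i.val < j → (c i : ℝ) ≤ N * y i ∧ N * y i ≤ c i + 1}

theorem closedConvex_gridCell (N j : ℕ) (c : Fin (m + 1) → ℕ) :
    ClosedConvex (gridCell N j c) := by
  refine ⟨{f | ∀ i : Fin (m + 1), i.val < j → (c i : ℝ) ≤ N * f i ∧ N * f i ≤ c i + 1},
    ?_, ?_, rfl⟩
  · simp only [ofPred_forall, ofPred_and]
    refine isClosed_iInter fun i => isClosed_iInter fun _ => ?_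
    exact (isClosed_le continuous_const (continuous_const.mul (continuous_apply i))).inter
      (isClosed_le (continuous_const.mul (continuous_apply i)) continuous_const)
  · intro x hx y hy a b ha hb hab i hi
    obtain ⟨h1, h2⟩ := hx i hi
    obtain ⟨h3, h4⟩ := hy i hi
    simp only [Pi.add_apply, Pi.smul_apply, smul_eq_mul]
    have e : (N : ℝ) * (a * x i + b * y i) = a * (N * x i) + b * (N * y i) := by ring
    have e1 : ∀ t : ℝ, t = a * t + b * t := fun t => by rw [← add_mul, hab, one_mul]
    rw [e]
    constructor
    · rw [e1 (c i)]; gcongr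
    · rw [e1 (c i + 1 : ℝ)]; gcongr

theorem closedConvex_coord_le (i : Fin (m + 1)) (r N : ℝ) :
    ClosedConvex {y : Simplex m | N * y i ≤ r} := by
  refine ⟨{f | N * f i ≤ r}, isClosed_le (continuous_const.mul (continuous_apply i))
    continuous_const, ?_, rfl⟩
  intro x hx y hy a b ha hb hab
  simp only [mem_ofPred_eq, Pi.add_apply, Pi.smul_apply, smul_eq_mul] at *
  have e : N * (a * x i + b * y i) = a * (N * x i) + b * (N * y i) := by ring
  have e1 : r = a * r + b * r := by rw [← add_mul, hab, one_mul]
  rw [e, e1]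
  gcongr

/-- A property of closed convex subsets of a simplex that holds locally and is stable under
unions holds for the whole simplex. -/
theorem simplex_induction (Q : Set (Simplex m) → Prop)
    (hloc : ∀ y, ∃ U ∈ 𝓝 y, ∀ K ⊆ U, ClosedConvex K → Q K)
    (hglue : ∀ A C, ClosedConvex A → ClosedConvex C → Q A → Q C → Q (A ∪ C)) : Q univ := by
  choose U hU hQ using hloc
  obtain ⟨δ, hδ, hL⟩ := lebesgue_number_lemma_of_metric (s := (univ : Set (Simplex m)))
    isCompact_univ (c := fun y => interior (U y)) (fun _ => isOpen_interior)
    (fun y _ => mem_iUnion.2 ⟨y, mem_interior_iff_mem_nhds.2 (hU y)⟩)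
  obtain ⟨N, hN⟩ := exists_nat_gt (1 / δ)
  have hN0 : (0 : ℝ) < N := lt_trans (by positivity) hN
  have hNδ : 1 < N * δ := by rwa [div_lt_iff₀ hδ] at hN
  -- Induction on the number `d` of unconstrained coordinates. With none left, a cell has sup
  -- diameter at most `1 / N < δ`, so it lies in one of the given neighbourhoods.
  have main : ∀ d j : ℕ, j + d = m + 1 → ∀ c : Fin (m + 1) → ℕ, Q (gridCell N j c) := by
    intro d
    induction d with
    | zero =>
      intro j hj c
      by_cases hne : (gridCell N j c).Nonempty
      · obtain ⟨y, hy⟩ := hne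
        obtain ⟨z, hz⟩ := hL y (mem_univ _)
        refine hQ z _ ((fun w hw => interior_subset (hz ?_))) (closedConvex_gridCell N j c)
        rw [Metric.mem_ball, Subtype.dist_eq, dist_pi_lt_iff hδ]
        intro i
        obtain ⟨h1, h2⟩ := hy i (by omega)
        obtain ⟨h3, h4⟩ := hw i (by omega)
        rw [Real.dist_eq]
        have h5 : (N : ℝ) * |w i - y i| ≤ 1 := by
          have h6 : (N : ℝ) * |w i - y i| = |(N : ℝ) * w i - N * y i| := by
            rw [← mul_sub, abs_mul, abs_of_pos hN0]
          rw [h6, abs_le]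
          constructor <;> linarith
        exact lt_of_mul_lt_mul_left (h5.trans_lt hNδ) hN0.le
      · rw [not_nonempty_iff_eq_empty] at hne
        rw [hne]
        exact hQ (vertex 0) ∅ (empty_subset _)
          ⟨∅, isClosed_empty, convex_empty, rfl⟩
    | succ d ih =>
      intro j hj c
      let i₀ : Fin (m + 1) := ⟨j, by omega⟩
      have hcell : ∀ r : ℕ, gridCell N (j + 1) (Function.update c i₀ r) =
          gridCell N j c ∩ {y : Simplex m | (r : ℝ) ≤ N * y i₀ ∧ N * y i₀ ≤ r + 1} := by
        intro r
        ext y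
        constructor
        · intro h
          refine ⟨fun i hi => ?_, ?_⟩
          · have hne : i ≠ i₀ := fun h => by simp [h, i₀] at hi
            simpa [Function.update_of_ne hne] using h i (by omega)
          · simpa using h i₀ (by simp [i₀])
        · rintro ⟨h, h'⟩ i hi
          by_cases hne : i = i₀
          · subst hne
            simpa using h'
          · have : i.val ≠ j := fun h => hne (Fin.ext h)
            simpa [Function.update_of_ne hne] using h i (by omega)
      -- Slabs of width `1 / N` in coordinate `j` are glued on one at a time; `r = N` exhausts the
      -- cell because coordinates are at most 1.
      have strip : ∀ r : ℕ, Q (gridCell N j c ∩ {y : Simplex m | N * y i₀ ≤ (r : ℝ) + 1}) := by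
        intro r
        induction r with
        | zero =>
          have h := ih (j + 1) (by omega) (Function.update c i₀ 0)
          rw [hcell] at h
          convert h using 3
          ext y
          have := stdSimplex.zero_le y i₀
          simp only [Nat.cast_zero, zero_add, iff_and_self]
          intro _
          positivity
        | succ r ihr =>
          have h := ih (j + 1) (by omega) (Function.update c i₀ (r + 1))
          have h' := hglue _ _ ((closedConvex_gridCell N j c).inter
            (closedConvex_coord_le i₀ _ _)) (closedConvex_gridCell _ _ _) ihr h
          rw [hcell, ← inter_union_distrib_left] at h'
          convert h' using 3
          ext y
          simp only [mem_ofPred_eq, mem_union, Nat.cast_add, Nat.cast_one]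
          constructor
          · intro h
            rcases le_total ((N : ℝ) * y i₀) (r + 1) with h1 | h1
            · exact Or.inl h1
            · exact Or.inr ⟨h1, h⟩
          · rintro (h | h)
            · linarith
            · exact h.2
      have h := strip N
      rwa [inter_eq_left.2] at h
      intro y _
      have h1 := stdSimplex.le_one y i₀
      simp only [mem_ofPred_eq]
      nlinarith
  have := main (m + 1) 0 (by omega) (fun _ => 0)
  convert this
  ext y
  simp [gridCell]

theorem continuousOn_union_of_eqOn {X Y : Type*} [TopologicalSpace X] [TopologicalSpace Y]
    {A C : Set X} (hA : IsClosed A) (hC : IsClosed C) {f g h : X → Y} (hf : ContinuousOn f A)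
    (hg : ContinuousOn g C) (hfA : EqOn h f A) (hgC : EqOn h g C) : ContinuousOn h (A ∪ C) :=
  (hf.congr hfA).union_of_isClosed (hg.congr hgC) hA hC

end SimplexInduction

/-! ### Extending lattice elements and covector fields over simplices -/

section SectionsOverSimplices

variable {n k m : ℕ} {B : Type*} [TopologicalSpace B] [ChartedSpace (EuclideanSpace ℝ (Fin n)) B]
  [IsManifold (𝓡 n) ∞ B] {P : ∀ x : B, AddSubgroup (Cot n x)}

open Classical in
/-- Elements of a lattice extend to sections along simplices. -/
theorem IsLattice.exists_section (hP : IsLattice k P) (σ : C(Simplex m, B)) (y : Simplex m)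
    {p : Cot n (σ y)} (hp : p ∈ P (σ y)) : ∃ q : Sections P σ, q.1 y = p := by
  let Q : Set (Simplex m) → Prop := fun K => ∀ y ∈ K, ∀ p ∈ P (σ y), ∃ q : ∀ y, Cot n (σ y),
    ContinuousOn (fun y => cotPt (q y)) K ∧ (∀ z ∈ K, q z ∈ P (σ z)) ∧ q y = p
  have half : ∀ A C, ClosedConvex A → ClosedConvex C → Q A → Q C → ∀ y ∈ A, ∀ p ∈ P (σ y),
      ∃ q : ∀ y, Cot n (σ y), ContinuousOn (fun y => cotPt (q y)) (A ∪ C) ∧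
        (∀ z ∈ A ∪ C, q z ∈ P (σ z)) ∧ q y = p := by
    intro A C hA hC hQA hQC y hy p hp
    obtain ⟨qA, hqA, hqAP, hqAy⟩ := hQA y hy p hp
    -- The overlap is convex, hence connected, so agreement at one of its points is agreement
    -- throughout; if it is empty, zero will do.
    obtain ⟨qC, hqC, hqCP, hqq⟩ : ∃ q : ∀ y, Cot n (σ y), ContinuousOn (fun y => cotPt (q y)) C ∧
        (∀ z ∈ C, q z ∈ P (σ z)) ∧ ∀ z ∈ A ∩ C, qA z = q z := by
      by_cases hne : (A ∩ C).Nonempty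
      · obtain ⟨z, hzA, hzC⟩ := hne
        obtain ⟨q, h1, h2, h3⟩ := hQC z hzC (qA z) (hqAP z hzA)
        exact ⟨q, h1, h2, hP.eqOn_of_isPreconnected (hA.inter hC).isPreconnected
          (hqA.mono inter_subset_left) (h1.mono inter_subset_right) (fun w hw => hqAP w hw.1)
          (fun w hw => h2 w hw.2) ⟨hzA, hzC⟩ h3.symm⟩
      · refine ⟨fun z => 0, continuousOn_zero σ.continuous.continuousOn, fun z _ => zero_mem _,
          fun z hz => (hne ⟨z, hz⟩).elim⟩
    have e1 : ∀ z ∈ A, (if z ∈ A then qA z else qC z) = qA z := fun z hz => if_pos hz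
    have e2 : ∀ z ∈ C, (if z ∈ A then qA z else qC z) = qC z := fun z hz => by
      by_cases h : z ∈ A
      · rw [if_pos h]; exact hqq z ⟨h, hz⟩
      · rw [if_neg h]
    refine ⟨fun z => if z ∈ A then qA z else qC z, ?_, ?_, ?_⟩
    · exact continuousOn_union_of_eqOn hA.isClosed hC.isClosed hqA hqC
        (fun z hz => congrArg cotPt (e1 z hz)) (fun z hz => congrArg cotPt (e2 z hz))
    · rintro z (hz | hz)
      · beta_reduce; rw [e1 z hz]; exact hqAP z hz
      · beta_reduce; rw [e2 z hz]; exact hqCP z hz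
    · exact (e1 y hy).trans hqAy
  have key : Q univ := by
    apply simplex_induction
    · intro y
      obtain ⟨U, hU, hyU, H⟩ := hP.exists_local_sections (σ y)
      refine ⟨σ ⁻¹' U, (hU.preimage σ.continuous).mem_nhds hyU, fun K hK _ z hz p hp => ?_⟩
      obtain ⟨q, hq, hqP, hqz⟩ := H (σ z) (hK hz) p hp
      exact ⟨fun w => q (σ w), hq.continuousOn.comp σ.continuous.continuousOn hK,
        fun w hw => hqP _ (hK hw), hqz⟩
    · intro A C hA hC hQA hQC y hy p hp
      rcases hy with hy | hy
      · exact half A C hA hC hQA hQC y hy p hp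
      · rw [union_comm]
        exact half C A hC hA hQC hQA y hy p hp
  obtain ⟨q, hq, hqP, hqy⟩ := key y (mem_univ _) p hp
  exact ⟨⟨q, fun z => hqP z (mem_univ _), continuousOn_univ.1 hq⟩, hqy⟩

open Classical in
/-- Continuous covector fields along a closed subset of a simplex extend to the simplex. -/
theorem exists_covector_extension (σ : C(Simplex m, B)) {Z : Set (Simplex m)} (hZ : IsClosed Z)
    {ξ : ∀ y, Cot n (σ y)} (hξ : ContinuousOn (fun y => cotPt (ξ y)) Z) :
    ∃ ξ' : ∀ y, Cot n (σ y), Continuous (fun y => cotPt (ξ' y)) ∧ ∀ z ∈ Z, ξ' z = ξ z := by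
  -- Quantifying over `Z` and `ξ` allows gluing by extending first over `A`, then from `A ∪ Z` over
  -- `C`. The local case is Tietze's theorem in coordinates.
  let Q : Set (Simplex m) → Prop := fun K => ∀ Z : Set (Simplex m), IsClosed Z →
    ∀ ξ : ∀ y, Cot n (σ y), ContinuousOn (fun y => cotPt (ξ y)) Z →
    ∃ ξ' : ∀ y, Cot n (σ y), ContinuousOn (fun y => cotPt (ξ' y)) K ∧ ∀ z ∈ Z ∩ K, ξ' z = ξ z
  have key : Q univ := by
    apply simplex_induction
    · intro y
      set b := σ y
      refine ⟨σ ⁻¹' (cotTriv (n := n) b).baseSet, σ.continuous.continuousAt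
        (cotTriv_mem_nhds (mem_cotTriv_self b)), fun K hK hKc Z hZ ξ hξ => ?_⟩
      have hg : ContinuousOn (fun z => cotCoord b (σ z) (ξ z)) (Z ∩ K) := fun z hz =>
        ((continuousWithinAt_cotPt_iff σ.continuous.continuousWithinAt (hK hz.2)).1
          (hξ z hz.1)).mono inter_subset_left
      have : TietzeExtension (CotModel n) := TietzeExtension.of_tvs ℝ
      obtain ⟨g, hg'⟩ := ContinuousMap.exists_restrict_eq (hZ.inter hKc.isClosed)
        ⟨_, hg.domRestrict⟩
      refine ⟨fun z => cotOfCoord b (σ z) (g z), fun z hz => ?_, fun z hz => ?_⟩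
      · rw [continuousWithinAt_cotPt_iff σ.continuous.continuousWithinAt (hK hz)]
        refine g.continuous.continuousWithinAt.congr (fun w hw => ?_) ?_
        · exact cotCoord_cotOfCoord (hK hw) _
        · exact cotCoord_cotOfCoord (hK hz) _
      · have : g z = cotCoord b (σ z) (ξ z) := DFunLike.congr_fun hg' ⟨z, hz⟩
        beta_reduce
        rw [this, cotOfCoord_cotCoord (hK hz.2)]
    · intro A C hA hC hQA hQC Z hZ ξ hξ
      obtain ⟨ξA, h1, h2⟩ := hQA Z hZ ξ hξ
      have e1 : ∀ z ∈ A, (if z ∈ A then ξA z else ξ z) = ξA z := fun z hz => if_pos hz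
      have e2 : ∀ z ∈ Z, (if z ∈ A then ξA z else ξ z) = ξ z := fun z hz => by
        by_cases h : z ∈ A
        · rw [if_pos h]; exact h2 z ⟨hz, h⟩
        · rw [if_neg h]
      obtain ⟨ξC, h3, h4⟩ := hQC (A ∪ Z) (hA.isClosed.union hZ)
        (fun z => if z ∈ A then ξA z else ξ z) (continuousOn_union_of_eqOn hA.isClosed hZ h1 hξ
          (fun z hz => congrArg cotPt (e1 z hz)) (fun z hz => congrArg cotPt (e2 z hz)))
      have e3 : ∀ z ∈ A, (if z ∈ A then ξA z else ξC z) = ξA z := fun z hz => if_pos hz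
      have e4 : ∀ z ∈ C, (if z ∈ A then ξA z else ξC z) = ξC z := fun z hz => by
        by_cases h : z ∈ A
        · rw [if_pos h, h4 z ⟨Or.inl h, hz⟩, if_pos h]
        · rw [if_neg h]
      refine ⟨fun z => if z ∈ A then ξA z else ξC z, continuousOn_union_of_eqOn hA.isClosed
        hC.isClosed h1 h3 (fun z hz => congrArg cotPt (e3 z hz))
        (fun z hz => congrArg cotPt (e4 z hz)), ?_⟩
      rintro z ⟨hz, hzA | hzC⟩
      · exact (e3 z hzA).trans (h2 z ⟨hz, hzA⟩)
      · exact (e4 z hzC).trans ((h4 z ⟨Or.inr hz, hzC⟩).trans (e2 z hz))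
  obtain ⟨ξ', h1, h2⟩ := key Z hZ ξ hξ
  exact ⟨ξ', continuousOn_univ.1 h1, fun z hz => h2 z ⟨hz, mem_univ _⟩⟩

end SectionsOverSimplices

end LatticeFibration

namespace LatticeFibration

namespace AffineFibration

/-! ### The action as a relation between points of a fibre -/

section Shift

variable {n k : ℕ} {B : Type*} [TopologicalSpace B] [ChartedSpace (EuclideanSpace ℝ (Fin n)) B]
  [IsManifold (𝓡 n) ∞ B] {P : ∀ x : B, AddSubgroup (Cot n x)}
  {E : Type*} [TopologicalSpace E] [ChartedSpace (EuclideanSpace ℝ (Fin (2 * n))) E]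

/-- `z' = v ∘ z` for a covector `v` at `x` and points `z`, `z'` of the fibre over `x`. -/
def IsShift (A : AffineFibration P E) {x : B} (v : Cot n x) (z z' : E) : Prop :=
  ∃ h : A.proj z = x, A.shift v z h = z'

variable {A : AffineFibration P E} {x : B} {v w : Cot n x} {z z' z'' : E}

theorem isShift_iff (hz : A.proj z = x) : A.IsShift v z z' ↔ z' = A.shift v z hz :=
  ⟨fun ⟨_, h⟩ => h.symm, fun h => ⟨hz, h.symm⟩⟩

theorem IsShift.proj_left (h : A.IsShift v z z') : A.proj z = x := h.1

theorem IsShift.proj_right (h : A.IsShift v z z') : A.proj z' = x := by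
  obtain ⟨hz, rfl⟩ := h
  exact ((QuotientAddGroup.mk v : Cot n x ⧸ P x) +ᵥ (⟨z, hz⟩ : A.Fiber x)).2

theorem IsShift.unique (h : A.IsShift v z z') (h' : A.IsShift v z z'') : z' = z'' := by
  obtain ⟨_, rfl⟩ := h
  obtain ⟨_, rfl⟩ := h'
  rfl

theorem IsShift.trans (h : A.IsShift v z z') (h' : A.IsShift w z' z'') :
    A.IsShift (v + w) z z'' := by
  obtain ⟨hz, rfl⟩ := h
  obtain ⟨hz', rfl⟩ := h'
  refine ⟨hz, ?_⟩
  simp only [shift, add_comm v w, QuotientAddGroup.mk_add, add_vadd]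

theorem isShift_of_mem (h : A.proj z = x) (hv : v ∈ P x) : A.IsShift v z z := by
  refine ⟨h, ?_⟩
  have : (QuotientAddGroup.mk v : Cot n x ⧸ P x) = 0 := (QuotientAddGroup.eq_zero_iff v).2 hv
  simp [shift, this]

theorem IsShift.add_mem (h : A.IsShift v z z') (hw : w ∈ P x) : A.IsShift (v + w) z z' :=
  h.trans (isShift_of_mem h.proj_right hw)

theorem exists_isShift (h : A.proj z = x) (h' : A.proj z' = x) :
    ∃ v : Cot n x, A.IsShift v z z' := by
  obtain ⟨a, ha, -⟩ := A.regular x ⟨z, h⟩ ⟨z', h'⟩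
  obtain ⟨v, rfl⟩ := QuotientAddGroup.mk_surjective a
  exact ⟨v, h, congrArg Subtype.val ha⟩

/-- Freeness of the action. It is the reason that two covectors carrying `z` to the same point
differ by a lattice element. -/
theorem IsShift.mem (h : A.IsShift v z z) : v ∈ P x := by
  obtain ⟨hz, h⟩ := h
  rw [← QuotientAddGroup.eq_zero_iff]
  refine (A.regular x ⟨z, hz⟩ ⟨z, hz⟩).unique (Subtype.ext h) ?_
  exact zero_vadd _ _

theorem IsShift.symm (h : A.IsShift v z z') : A.IsShift (-v) z' z := by
  obtain ⟨u, hu⟩ := exists_isShift h.proj_right h.proj_left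
  have := (hu.trans h).mem
  have h2 := hu.add_mem (neg_mem this)
  simpa using h2

theorem IsShift.sub_mem (h : A.IsShift v z z') (h' : A.IsShift w z z') : v - w ∈ P x := by
  simpa [sub_eq_add_neg] using (h.trans h'.symm).mem

theorem isShift_vadd {a : A.Fiber x} : A.IsShift v a.1
    ((QuotientAddGroup.mk v : Cot n x ⧸ P x) +ᵥ a).1 := ⟨a.2, rfl⟩

end Shift

/-! ### Local trivializations and local lifts to the cotangent bundle -/

section Local

variable {n k : ℕ} {B : Type*} [TopologicalSpace B] [ChartedSpace (EuclideanSpace ℝ (Fin n)) B]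
  [IsManifold (𝓡 n) ∞ B] {P : ∀ x : B, AddSubgroup (Cot n x)}
  {E : Type*} [TopologicalSpace E] [ChartedSpace (EuclideanSpace ℝ (Fin (2 * n))) E]

/-- `Φ : T*U → π⁻¹(U)` induces a trivialization of the affine fibration over `U`. -/
structure IsTrivializedBy (A : AffineFibration P E) (U : Set B) (Φ : CotBundle n B → E) :
    Prop where
  isOpen : IsOpen U
  proj_eq : ∀ x ∈ U, ∀ v : Cot n x, A.proj (Φ (cotPt v)) = x
  isShift : ∀ x ∈ U, ∀ v w : Cot n x, A.IsShift v (Φ (cotPt w)) (Φ (cotPt (v + w)))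
  localDiffeo : IsLocalDiffeomorphOn (cotI n) (𝓡 (2 * n)) ∞ Φ {ξ | ξ.proj ∈ U}

variable {A : AffineFibration P E} {U : Set B} {Φ : CotBundle n B → E}

theorem exists_isTrivializedBy (A : AffineFibration P E) (x₀ : B) :
    ∃ U Φ, x₀ ∈ U ∧ A.IsTrivializedBy U Φ := by
  obtain ⟨U, hU, hxU, Φ, hΦ, h1, h2⟩ := A.locallyTrivial x₀
  exact ⟨U, Φ, hxU, hU, hΦ, fun x hx v w => ⟨hΦ x hx w, congrArg Subtype.val (h1 x hx v w)⟩, h2⟩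

theorem IsTrivializedBy.mono (h : A.IsTrivializedBy U Φ) {V : Set B} (hV : IsOpen V)
    (hVU : V ⊆ U) : A.IsTrivializedBy V Φ :=
  ⟨hV, fun x hx => h.proj_eq x (hVU hx), fun x hx => h.isShift x (hVU hx),
    fun ξ => h.localDiffeo ⟨ξ.1, hVU ξ.2⟩⟩

theorem IsTrivializedBy.isShift_sub (h : A.IsTrivializedBy U Φ) {x : B} (hx : x ∈ U)
    (v w : Cot n x) : A.IsShift (v - w) (Φ (cotPt w)) (Φ (cotPt v)) := by
  simpa using h.isShift x hx (v - w) w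

theorem IsTrivializedBy.exists_eq (h : A.IsTrivializedBy U Φ) {z : E} {x : B} (hx : x ∈ U)
    (hz : A.proj z = x) : ∃ v : Cot n x, Φ (cotPt v) = z := by
  obtain ⟨v, hv⟩ := exists_isShift (h.proj_eq x hx 0) hz
  exact ⟨v + 0, (h.isShift x hx v 0).unique hv⟩

theorem IsTrivializedBy.contMDiffAt (h : A.IsTrivializedBy U Φ) {ξ : CotBundle n B}
    (hξ : ξ.proj ∈ U) : ContMDiffAt (cotI n) (𝓡 (2 * n)) ∞ Φ ξ :=
  (h.localDiffeo ⟨ξ, hξ⟩).contMDiffAt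

/-- Smooth local inverses of a trivialization. -/
theorem IsTrivializedBy.exists_local_inverse (h : A.IsTrivializedBy U Φ) {z₀ : E}
    (hz₀ : A.proj z₀ ∈ U) : ∃ Ψ : E → CotBundle n B, ∃ W : Set E, IsOpen W ∧ z₀ ∈ W ∧
      ContMDiffOn (𝓡 (2 * n)) (cotI n) ∞ Ψ W ∧
      ∀ z ∈ W, (Ψ z).proj = A.proj z ∧ A.proj z ∈ U ∧ Φ (Ψ z) = z := by
  obtain ⟨v, hv⟩ := h.exists_eq hz₀ rfl
  have hd : IsLocalDiffeomorphAt (cotI n) (𝓡 (2 * n)) ∞ Φ (cotPt v) :=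
    h.localDiffeo ⟨cotPt v, hz₀⟩
  have hsm := hd.localInverse_contMDiffOn
  have hmem := hd.localInverse_mem_source
  have hl : hd.localInverse (Φ (cotPt v)) = cotPt v :=
    hd.localInverse_left_inv hd.localInverse_mem_target
  rw [hv] at hmem hl
  have hpr : ContinuousOn (fun z => (hd.localInverse z).proj) hd.localInverse.source :=
    (FiberBundle.continuous_proj (CotModel n) (fun x : B => Cot n x)).comp_continuousOn
      hsm.continuousOn
  refine ⟨hd.localInverse, _, hpr.isOpen_inter_preimage hd.localInverse_open_source h.isOpen,
    ⟨hmem, by simp only [mem_preimage, hl]; exact hz₀⟩, hsm.mono inter_subset_left, ?_⟩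
  rintro z ⟨h1, h2⟩
  have h3 : Φ (hd.localInverse z) = z := hd.localInverse_right_inv h1
  have h4 := h.proj_eq _ h2 (hd.localInverse z).2
  have h5 : A.proj z = (hd.localInverse z).proj := by
    rw [← h3]; exact h4.trans (by rw [h3])
  exact ⟨h5.symm, h5 ▸ h2, h3⟩

variable {X : Type*} [TopologicalSpace X] {σ : X → B} {K : Set X} {y₀ : X} {t t' : X → E}

/-- Lifts of a map to `E` lift locally to `T*B`. -/
theorem IsTrivializedBy.exists_local_covector (h : A.IsTrivializedBy U Φ) (hy₀ : y₀ ∈ K)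
    (hσ : σ y₀ ∈ U) (ht : ContinuousOn t K) (htσ : ∀ y ∈ K, A.proj (t y) = σ y) :
    ∃ w : ∀ y, Cot n (σ y), ∃ V ∈ 𝓝 y₀, ContinuousOn (fun y => cotPt (w y)) (V ∩ K) ∧
      ∀ y ∈ V ∩ K, σ y ∈ U ∧ Φ (cotPt (w y)) = t y := by
  rw [← htσ y₀ hy₀] at hσ
  obtain ⟨Ψ, W, hW, hzW, hΨ, hev⟩ := h.exists_local_inverse hσ
  obtain ⟨w, hw⟩ := exists_cotPt_eq (f := σ) (fun y => Ψ (t y))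
  obtain ⟨V, hV, hVW⟩ := mem_nhdsWithin_iff_exists_mem_nhds_inter.1
    ((ht y₀ hy₀).preimage_mem_nhdsWithin (hW.mem_nhds hzW))
  have hev' : ∀ y ∈ V ∩ K, cotPt (w y) = Ψ (t y) ∧ σ y ∈ U ∧ Φ (cotPt (w y)) = t y := by
    intro y hy
    have h1 := hev _ (hVW hy)
    have h3 := hw y (h1.1.trans (htσ y hy.2))
    exact ⟨h3, htσ y hy.2 ▸ h1.2.1, by rw [h3, h1.2.2]⟩
  refine ⟨w, V, hV, ?_, fun y hy => (hev' y hy).2⟩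
  exact (hΨ.continuousOn.comp (ht.mono inter_subset_right) hVW).congr fun y hy => (hev' y hy).1

/-- Shifting a continuous lift by a continuous covector field gives a continuous lift. -/
theorem continuousOn_of_isShift (ht : ContinuousOn t K)
    {ξ : ∀ y, Cot n (σ y)} (hξ : ContinuousOn (fun y => cotPt (ξ y)) K)
    (h : ∀ y ∈ K, A.IsShift (ξ y) (t y) (t' y)) : ContinuousOn t' K := by
  intro y₀ hy₀
  obtain ⟨U, Φ, hU, hΦ⟩ := A.exists_isTrivializedBy (σ y₀)
  obtain ⟨w, V, hV, hw, hev⟩ :=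
    hΦ.exists_local_covector hy₀ hU ht (fun y hy => (h y hy).proj_left)
  -- Near `y₀` the lift `t` is `Φ(w)`, so by equivariance `t'` is `Φ(ξ + w)`.
  have h1 := continuousOn_add (hξ.mono inter_subset_right) hw
  have h2 : ContinuousOn (fun y => Φ (cotPt (ξ y + w y))) (V ∩ K) := fun y hy =>
    ContinuousAt.comp_continuousWithinAt (g := Φ) (f := fun y => cotPt (ξ y + w y))
      (hΦ.contMDiffAt (ξ := cotPt (ξ y + w y)) (hev y hy).1).continuousAt (h1 y hy)
  have h3 : ContinuousOn t' (V ∩ K) := by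
    refine h2.congr fun y hy => ?_
    have h5 := hΦ.isShift _ (hev y hy).1 (ξ y) (w y)
    rw [(hev y hy).2] at h5
    exact (h y hy.2).unique h5
  exact (h3 y₀ ⟨mem_of_mem_nhds hV, hy₀⟩).mono_of_mem_nhdsWithin
    (Filter.inter_mem (mem_nhdsWithin_of_mem_nhds hV) self_mem_nhdsWithin)

/-- Locally, two continuous lifts differ by a continuous covector field. -/
theorem exists_local_difference (hy₀ : y₀ ∈ K) (ht : ContinuousOn t K)
    (ht' : ContinuousOn t' K) (htσ : ∀ y ∈ K, A.proj (t y) = σ y)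
    (htσ' : ∀ y ∈ K, A.proj (t' y) = σ y) :
    ∃ ξ : ∀ y, Cot n (σ y), ∃ V ∈ 𝓝 y₀, ContinuousOn (fun y => cotPt (ξ y)) (V ∩ K) ∧
      ∀ y ∈ V ∩ K, A.IsShift (ξ y) (t y) (t' y) := by
  obtain ⟨U, Φ, hU, hΦ⟩ := A.exists_isTrivializedBy (σ y₀)
  obtain ⟨w, V, hV, hw, hev⟩ := hΦ.exists_local_covector hy₀ hU ht htσ
  obtain ⟨w', V', hV', hw', hev'⟩ := hΦ.exists_local_covector hy₀ hU ht' htσ'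
  refine ⟨fun y => w' y - w y, V ∩ V', Filter.inter_mem hV hV',
    continuousOn_sub (hw'.mono fun y hy => ⟨hy.1.2, hy.2⟩)
      (hw.mono fun y hy => ⟨hy.1.1, hy.2⟩), fun y hy => ?_⟩
  obtain ⟨h1, h2⟩ := hev y ⟨hy.1.1, hy.2⟩
  obtain ⟨-, h2'⟩ := hev' y ⟨hy.1.2, hy.2⟩
  have := hΦ.isShift_sub h1 (w' y) (w y)
  rwa [h2, h2'] at this

end Local

/-! ### Lifting simplices to `E` and comparing two lifts -/

section Lifts

variable {n k m : ℕ} {B : Type*} [TopologicalSpace B] [ChartedSpace (EuclideanSpace ℝ (Fin n)) B]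
  [IsManifold (𝓡 n) ∞ B] {P : ∀ x : B, AddSubgroup (Cot n x)}
  {E : Type*} [TopologicalSpace E] [ChartedSpace (EuclideanSpace ℝ (Fin (2 * n))) E]
  {A : AffineFibration P E}

open Classical in
/-- Two continuous lifts over a closed convex subset of a simplex differ by a continuous covector
field. -/
theorem exists_covector_lift (hP : IsLattice k P) {σ : C(Simplex m, B)} {K₀ : Set (Simplex m)}
    (hK₀ : ClosedConvex K₀) {t t' : Simplex m → E} (ht : ContinuousOn t K₀)
    (ht' : ContinuousOn t' K₀) (htσ : ∀ y ∈ K₀, A.proj (t y) = σ y)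
    (htσ' : ∀ y ∈ K₀, A.proj (t' y) = σ y) :
    ∃ ξ : ∀ y, Cot n (σ y), ContinuousOn (fun y => cotPt (ξ y)) K₀ ∧
      ∀ y ∈ K₀, A.IsShift (ξ y) (t y) (t' y) := by
  let Q : Set (Simplex m) → Prop := fun K => ∃ ξ : ∀ y, Cot n (σ y),
    ContinuousOn (fun y => cotPt (ξ y)) (K ∩ K₀) ∧ ∀ y ∈ K ∩ K₀, A.IsShift (ξ y) (t y) (t' y)
  have key : Q univ := by
    apply simplex_induction
    · intro y
      by_cases hy : y ∈ K₀
      · obtain ⟨ξ, V, hV, h1, h2⟩ := exists_local_difference hy ht ht' htσ htσ'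
        exact ⟨V, hV, fun K hK _ => ⟨ξ, h1.mono (inter_subset_inter_left _ hK),
          fun z hz => h2 z ⟨hK hz.1, hz.2⟩⟩⟩
      · refine ⟨K₀ᶜ, hK₀.isClosed.isOpen_compl.mem_nhds hy, fun K hK _ => ⟨fun _ => 0, ?_, ?_⟩⟩
        · exact continuousOn_zero σ.continuous.continuousOn
        · exact fun z hz => (hK hz.1 hz.2).elim
    · rintro A' C hA hC ⟨ξA, hA1, hA2⟩ ⟨ξC, hC1, hC2⟩
      -- On the connected overlap `ξA - ξC` is a section of `P`, hence the restriction of a section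
      -- `p` over the simplex. Adding `p` to `ξC` makes the pieces agree and leaves the shifts
      -- unchanged.
      obtain ⟨p, hp, hpP, hpe⟩ : ∃ p : ∀ y, Cot n (σ y), Continuous (fun y => cotPt (p y)) ∧
          (∀ y, p y ∈ P (σ y)) ∧ ∀ y ∈ (A' ∩ C) ∩ K₀, ξA y - ξC y = p y := by
        by_cases hne : ((A' ∩ C) ∩ K₀).Nonempty
        · obtain ⟨z, hz⟩ := hne
          have hmem : ∀ y ∈ (A' ∩ C) ∩ K₀, ξA y - ξC y ∈ P (σ y) := fun y hy =>
            (hA2 y ⟨hy.1.1, hy.2⟩).sub_mem (hC2 y ⟨hy.1.2, hy.2⟩)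
          obtain ⟨q, hq⟩ := hP.exists_section σ z (hmem z hz)
          refine ⟨q.1, q.2.2, q.2.1, hP.eqOn_of_isPreconnected
            ((hA.inter hC).inter hK₀).isPreconnected
            (continuousOn_sub (hA1.mono fun y hy => ⟨hy.1.1, hy.2⟩)
              (hC1.mono fun y hy => ⟨hy.1.2, hy.2⟩)) q.2.2.continuousOn hmem
            (fun y _ => q.2.1 y) hz hq.symm⟩
        · exact ⟨fun _ => 0, continuous_zero_lift σ, fun y => zero_mem _,
            fun y hy => (hne ⟨y, hy⟩).elim⟩
      have e1 : ∀ y ∈ A' ∩ K₀, (if y ∈ A' then ξA y else ξC y + p y) = ξA y :=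
        fun y hy => if_pos hy.1
      have e2 : ∀ y ∈ C ∩ K₀, (if y ∈ A' then ξA y else ξC y + p y) = ξC y + p y := by
        intro y hy
        by_cases h : y ∈ A'
        · rw [if_pos h, ← hpe y ⟨⟨h, hy.1⟩, hy.2⟩, add_sub_cancel]
        · rw [if_neg h]
      refine ⟨fun y => if y ∈ A' then ξA y else ξC y + p y, ?_, ?_⟩
      · rw [union_inter_distrib_right]
        exact continuousOn_union_of_eqOn (hA.inter hK₀).isClosed (hC.inter hK₀).isClosed hA1
          (continuousOn_add hC1 hp.continuousOn) (fun z hz => congrArg cotPt (e1 z hz))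
          (fun z hz => congrArg cotPt (e2 z hz))
      · rintro y ⟨hy | hy, hy'⟩
        · beta_reduce
          rw [e1 y ⟨hy, hy'⟩]
          exact hA2 y ⟨hy, hy'⟩
        · beta_reduce
          rw [e2 y ⟨hy, hy'⟩]
          exact (hC2 y ⟨hy, hy'⟩).add_mem (hpP y)
  obtain ⟨ξ, h1, h2⟩ := key
  rw [univ_inter] at h1 h2
  exact ⟨ξ, h1, h2⟩

/-- Two continuous lifts of a singular simplex differ by a continuous covector field, with
prescribed value at one point. -/
theorem exists_covector_lift_of_eq (hP : IsLattice k P) {σ : C(Simplex m, B)}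
    (t t' : C(Simplex m, E)) (htσ : ∀ y, A.proj (t y) = σ y) (htσ' : ∀ y, A.proj (t' y) = σ y)
    (y₀ : Simplex m) {a : Cot n (σ y₀)} (ha : A.IsShift a (t y₀) (t' y₀)) :
    ∃ ξ : ∀ y, Cot n (σ y), Continuous (fun y => cotPt (ξ y)) ∧
      (∀ y, A.IsShift (ξ y) (t y) (t' y)) ∧ ξ y₀ = a := by
  obtain ⟨ξ, h1, h2⟩ := exists_covector_lift hP closedConvex_univ t.continuous.continuousOn
    t'.continuous.continuousOn (fun y _ => htσ y) (fun y _ => htσ' y)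
  obtain ⟨q, hq⟩ := hP.exists_section σ y₀ (ha.sub_mem (h2 y₀ (mem_univ _)))
  refine ⟨fun y => ξ y + q.1 y, continuous_add (continuousOn_univ.1 h1) q.2.2,
    fun y => (h2 y (mem_univ _)).add_mem (q.2.1 y), ?_⟩
  beta_reduce
  rw [hq, add_sub_cancel]

theorem exists_point (A : AffineFibration P E) (x : B) : ∃ z, A.proj z = x := by
  obtain ⟨U, Φ, hU, hΦ⟩ := A.exists_isTrivializedBy x
  exact ⟨_, hΦ.proj_eq x hU 0⟩

open Classical in
/-- Singular simplices lift to an affine fibration. -/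
theorem exists_lift (hP : IsLattice k P) (A : AffineFibration P E) (σ : C(Simplex m, B)) :
    ∃ t : C(Simplex m, E), ∀ y, A.proj (t y) = σ y := by
  let Q : Set (Simplex m) → Prop := fun K => ∃ t : Simplex m → E, ContinuousOn t K ∧
    ∀ y ∈ K, A.proj (t y) = σ y
  have key : Q univ := by
    apply simplex_induction
    · intro y
      obtain ⟨U, Φ, hU, hΦ⟩ := A.exists_isTrivializedBy (σ y)
      refine ⟨σ ⁻¹' U, (hΦ.isOpen.preimage σ.continuous).mem_nhds hU, fun K hK _ =>
        ⟨fun y => Φ (cotPt (0 : Cot n (σ y))), fun z hz => ?_, fun z hz => hΦ.proj_eq _ (hK hz) 0⟩⟩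
      exact ContinuousAt.comp_continuousWithinAt (g := Φ)
        (f := fun y => cotPt (0 : Cot n (σ y)))
        (hΦ.contMDiffAt (ξ := cotPt (0 : Cot n (σ z))) (hK hz)).continuousAt
        (continuous_zero_lift σ).continuousWithinAt
    · rintro A' C hA hC ⟨tA, hA1, hA2⟩ ⟨tC, hC1, hC2⟩
      -- Over the convex overlap the two lifts differ by a covector field; its extension to the
      -- simplex moves `tC` to a lift that agrees with `tA` there.
      obtain ⟨ξ, hξ, hξt⟩ := exists_covector_lift hP (hA.inter hC) (hC1.mono inter_subset_right)
        (hA1.mono inter_subset_left) (fun y hy => hC2 y hy.2) (fun y hy => hA2 y hy.1)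
      obtain ⟨ξ', hξ', he⟩ := exists_covector_extension σ (hA.inter hC).isClosed hξ
      have hex : ∀ y, ∃ z, y ∈ C → A.IsShift (ξ' y) (tC y) z := by
        intro y
        by_cases hy : y ∈ C
        · exact ⟨_, fun _ => ⟨hC2 y hy, rfl⟩⟩
        · exact ⟨tC y, fun h => (hy h).elim⟩
      choose tC' hC' using hex
      have hC3 : ContinuousOn tC' C := continuousOn_of_isShift hC1 hξ'.continuousOn hC'
      refine ⟨fun y => if y ∈ A' then tA y else tC' y, ?_, ?_⟩
      · refine continuousOn_union_of_eqOn hA.isClosed hC.isClosed hA1 hC3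
          (fun y hy => if_pos hy) (fun y hy => ?_)
        by_cases h : y ∈ A'
        · have h1 := hC' y hy
          rw [he y ⟨h, hy⟩] at h1
          exact (if_pos h).trans ((hξt y ⟨h, hy⟩).unique h1)
        · exact if_neg h
      · intro y hy
        beta_reduce
        by_cases h : y ∈ A'
        · rw [if_pos h]; exact hA2 y h
        · rw [if_neg h]; exact (hC' y (hy.resolve_left h)).proj_right
  obtain ⟨t, h1, h2⟩ := key
  exact ⟨⟨t, continuousOn_univ.1 h1⟩, fun y => h2 y (mem_univ _)⟩

end Lifts

end AffineFibration

end LatticeFibration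

namespace LatticeFibration

/-! ### Simplicial identities and alternating sums -/

section Faces

theorem face_vertex {k : ℕ} (i : Fin (k + 2)) (j : Fin (k + 1)) :
    face i (vertex j) = vertex (i.succAbove j) := by
  simp [face, vertex]

/-- Composites of faces are determined by their maps of vertices, so each simplicial identity is a
finite check. -/
theorem face_comp_face {k : ℕ} {i i' : Fin (k + 3)} {j j' : Fin (k + 2)}
    (h : i.succAbove ∘ j.succAbove = i'.succAbove ∘ j'.succAbove) :
    (face i).comp (face j) = (face i').comp (face j') := by
  ext1 y
  simp only [face, ContinuousMap.comp_apply, ContinuousMap.coe_mk, stdSimplex.map_comp_apply, h]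

theorem alternating_sum_three {M : Type*} [AddCommGroup M] (f : Fin (1 + 2) → M) :
    ∑ i : Fin (1 + 2), ((-1 : ℤ) ^ (i : ℕ)) • f i = f 0 - f 1 + f 2 := by
  refine (Fin.sum_univ_three (fun i : Fin 3 => ((-1 : ℤ) ^ (i : ℕ)) • f i)).trans ?_
  simp [sub_eq_add_neg]

theorem alternating_sum_four {M : Type*} [AddCommGroup M] (f : Fin (2 + 2) → M) :
    ∑ i : Fin (2 + 2), ((-1 : ℤ) ^ (i : ℕ)) • f i = f 0 - f 1 + f 2 - f 3 := by
  refine (Fin.sum_univ_four (fun i : Fin 4 => ((-1 : ℤ) ^ (i : ℕ)) • f i)).trans ?_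
  have h3 : ((-1 : ℤ) ^ ((3 : Fin 4) : ℕ)) • f 3 = -f 3 := by
    rw [show ((3 : Fin 4) : ℕ) = 3 from rfl]
    norm_num
  rw [h3]
  simp [sub_eq_add_neg]

end Faces

/-! ### Lattice sections over spaces without monodromy -/

section Extension

variable {n k m : ℕ} {B : Type*} [TopologicalSpace B] [ChartedSpace (EuclideanSpace ℝ (Fin n)) B]
  [IsManifold (𝓡 n) ∞ B] {P : ∀ x : B, AddSubgroup (Cot n x)}
  {X Y : Type*} [TopologicalSpace X] [TopologicalSpace Y]

/-- The lattice `P` has no monodromy along `σ`. -/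
def HasExtensions (P : ∀ x : B, AddSubgroup (Cot n x)) (σ : C(X, B)) : Prop :=
  ∀ y, ∀ p ∈ P (σ y), ∃ q : Sections P σ, q.1 y = p

theorem sections_add_apply {σ : C(X, B)} (p q : Sections P σ) (y : X) :
    (p + q).1 y = p.1 y + q.1 y := rfl

theorem sections_sub_apply {σ : C(X, B)} (p q : Sections P σ) (y : X) :
    (p - q).1 y = p.1 y - q.1 y := rfl

theorem sections_zero_apply {σ : C(X, B)} (y : X) : (0 : Sections P σ).1 y = 0 := rfl

theorem IsLattice.hasExtensions (hP : IsLattice k P) (σ : C(Simplex m, B)) : HasExtensions P σ :=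
  fun y _ hp => hP.exists_section σ y hp

theorem IsLattice.sections_ext (hP : IsLattice k P) [PreconnectedSpace X] {σ : C(X, B)}
    {p q : Sections P σ} (y : X) (h : p.1 y = q.1 y) : p = q :=
  Subtype.ext (funext fun z => hP.eqOn_of_isPreconnected isPreconnected_univ p.2.2.continuousOn
    q.2.2.continuousOn (fun y _ => p.2.1 y) (fun y _ => q.2.1 y) (mem_univ y) h z (mem_univ z))

/-- Continue one value of `r` over `X`; unique continuation on `Y` does the rest. With
`restrict_injective`, this lets coefficients along all simplices of `X` be computed in the one group
`Sections P σ`. -/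
theorem IsLattice.exists_restrict_eq (hP : IsLattice k P) [PreconnectedSpace Y] [Nonempty Y]
    {σ : C(X, B)} (hσ : HasExtensions P σ) (e : C(Y, X)) (r : Sections P (σ.comp e)) :
    ∃ R : Sections P σ, restrict R e = r := by
  obtain ⟨y⟩ := ‹Nonempty Y›
  obtain ⟨R, hR⟩ := hσ (e y) (r.1 y) (r.2.1 y)
  exact ⟨R, hP.sections_ext y hR⟩

theorem restrict_injective (hP : IsLattice k P) [PreconnectedSpace X] [Nonempty Y]
    {σ : C(X, B)} (e : C(Y, X)) {p q : Sections P σ} (h : restrict p e = restrict q e) : p = q := by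
  obtain ⟨y⟩ := ‹Nonempty Y›
  exact hP.sections_ext (e y) (congrFun (congrArg Subtype.val h) y)

end Extension

/-! ### Holonomy, obstruction cochains and their cohomology class -/

section Holonomy

open AffineFibration

variable {n k m : ℕ} {B : Type*} [TopologicalSpace B] [ChartedSpace (EuclideanSpace ℝ (Fin n)) B]
  [IsManifold (𝓡 n) ∞ B] {P : ∀ x : B, AddSubgroup (Cot n x)}
  {E : Type*} [TopologicalSpace E] [ChartedSpace (EuclideanSpace ℝ (Fin (2 * n))) E]
  {A : AffineFibration P E} {X : Type*} [TopologicalSpace X]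

/-- In terms of a section `t` of `E` along `σ : X → B`, the section `s` over the `1`-skeleton is
given by the covectors `b` at the points of `X`, and it differs by `G e` from a lift to the
cotangent bundle along the path `e` in `X`. -/
structure IsHolonomy (s : SectionOnOneSkeleton A) (σ : C(X, B)) (t : C(X, E))
    (b : ∀ y, Cot n (σ y)) (G : C(Simplex 1, X) → Sections P σ) : Prop where
  base : ∀ y, A.IsShift (b y) (t y) (s.pt (σ y))
  edge : ∀ e : C(Simplex 1, X), ∃ ξ : ∀ u, Cot n (σ (e u)), Continuous (fun u => cotPt (ξ u)) ∧
    (∀ u, A.IsShift (ξ u) (t (e u)) (s.edge (σ.comp e) u)) ∧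
    ξ (vertex 0) = b (e (vertex 0)) ∧ ξ (vertex 1) = b (e (vertex 1)) + (G e).1 (e (vertex 1))

/-- The `b` are chosen pointwise, without continuity. The lift along `e` that starts at `b` ends at
a covector carrying `t` to the same point as `b` does; the discrepancy lies in `P` and is continued
over `X`. -/
theorem IsLattice.exists_isHolonomy (hP : IsLattice k P) (s : SectionOnOneSkeleton A)
    {σ : C(X, B)} (hσ : HasExtensions P σ) (t : C(X, E)) (ht : ∀ y, A.proj (t y) = σ y) :
    ∃ b G, IsHolonomy s σ t b G := by
  choose b hb using fun y => exists_isShift (ht y) (s.proj_pt (σ y))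
  have : ∀ e : C(Simplex 1, X), ∃ G : Sections P σ, ∃ ξ : ∀ u, Cot n (σ (e u)),
      Continuous (fun u => cotPt (ξ u)) ∧
      (∀ u, A.IsShift (ξ u) (t (e u)) (s.edge (σ.comp e) u)) ∧
      ξ (vertex 0) = b (e (vertex 0)) ∧
      ξ (vertex 1) = b (e (vertex 1)) + G.1 (e (vertex 1)) := by
    intro e
    have hv : ∀ i, A.IsShift (b (e (vertex i))) (t (e (vertex i)))
        (s.edge (σ.comp e) (vertex i)) := fun i => by
      rw [s.edge_vertex]
      exact hb _
    obtain ⟨ξ, h1, h2, h3⟩ : ∃ ξ : ∀ u, Cot n (σ (e u)), Continuous (fun u => cotPt (ξ u)) ∧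
        (∀ u, A.IsShift (ξ u) (t (e u)) (s.edge (σ.comp e) u)) ∧
        ξ (vertex 0) = b (e (vertex 0)) := exists_covector_lift_of_eq hP (σ := σ.comp e) (t.comp e)
      (s.edge (σ.comp e)) (fun u => ht _) (fun u => s.proj_edge _ _) (vertex 0) (hv 0)
    obtain ⟨G, hG⟩ := hσ (e (vertex 1)) (ξ (vertex 1) - b (e (vertex 1)))
      ((h2 (vertex 1)).sub_mem (hv 1))
    exact ⟨G, ξ, h1, h2, h3, by rw [hG, add_sub_cancel]⟩
  choose G hG using this
  exact ⟨b, G, hb, hG⟩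

/-- Vertices reached along different faces coincide only propositionally; this moves an equality in
the total space to the fibre over the common vertex. -/
theorem cotPt_section_eq {σ : X → B} {p q : ∀ y, Cot n (σ y)} {w w' v : X}
    (h : cotPt (p w) = cotPt (q w')) (hw : w = v) (hw' : w' = v) : p v = q v := by
  subst hw hw'
  exact eq_of_cotPt_eq h

/-- Obstruction cochains are computed by the holonomy along the faces. -/
theorem IsHolonomy.obstruction_eq (hP : IsLattice k P) {s : SectionOnOneSkeleton A}
    {c : Cochain P 2} (hc : IsObstructionCochain s c) {σ : C(X, B)} {t : C(X, E)}
    {b : ∀ y, Cot n (σ y)} {G : C(Simplex 1, X) → Sections P σ} (hG : IsHolonomy s σ t b G)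
    (h : C(Simplex 2, X)) :
    c (σ.comp h) =
      restrict (G (h.comp (face 0)) - G (h.comp (face 1)) + G (h.comp (face 2))) h := by
  obtain ⟨t', ht', ξ', hξc, hξt, e1, e2, e3⟩ := hc (σ.comp h)
  obtain ⟨ζ, hζc, hζ⟩ := exists_covector_lift hP (σ := σ.comp h) closedConvex_univ
    (t.comp h).continuous.continuousOn t'.continuous.continuousOn
    (fun y _ => (hG.base (h y)).proj_left) (fun y _ => ht' y)
  let b' : ∀ w, Cot n (σ.comp h w) := fun w => b (h w)
  let G' : Fin 3 → Sections P (σ.comp h) := fun i => restrict (G (h.comp (face i))) h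
  -- Compared through `ζ`, the lift in the definition and the holonomy lift along a face differ by a
  -- section of `P`, so by one `R i` at both ends. The three matching conditions become the linear
  -- relations `k1`, `k2`, `k3`, and eliminating `R` gives the formula.
  have hR : ∀ i : Fin 3, ∃ R : Sections P (σ.comp h),
      ξ' i (vertex 0) = R.1 (face i (vertex 0)) - ζ (face i (vertex 0)) + b' (face i (vertex 0))
      ∧ ξ' i (vertex 1) = R.1 (face i (vertex 1)) - ζ (face i (vertex 1)) +
        b' (face i (vertex 1)) + (G' i).1 (face i (vertex 1)) := by
    intro i
    obtain ⟨ξ, h1, h2, h3, h4⟩ : ∃ ξ : ∀ u, Cot n (σ.comp h (face i u)),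
        Continuous (fun u => cotPt (ξ u)) ∧
        (∀ u, A.IsShift (ξ u) (t (h (face i u))) (s.edge ((σ.comp h).comp (face i)) u)) ∧
        ξ (vertex 0) = b' (face i (vertex 0)) ∧
        ξ (vertex 1) = b' (face i (vertex 1)) + (G' i).1 (face i (vertex 1)) :=
      hG.edge (h.comp (face i))
    have hmem : ∀ u, ζ (face i u) + ξ' i u - ξ u ∈ P (σ.comp h (face i u)) := fun u =>
      ((hζ (face i u) (mem_univ _)).trans ⟨ht' _, (hξt i u).symm⟩).sub_mem (h2 u)
    obtain ⟨R, hR⟩ := hP.exists_restrict_eq (hP.hasExtensions (σ.comp h)) (face i)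
      ⟨fun u => ζ (face i u) + ξ' i u - ξ u, hmem, continuous_sub_lift (continuous_add
        ((continuousOn_univ.1 hζc).comp (face i).continuous) (hξc i)) h1⟩
    have hR' : ∀ u, ξ' i u = R.1 (face i u) - ζ (face i u) + ξ u := by
      intro u
      have : R.1 (face i u) = ζ (face i u) + ξ' i u - ξ u :=
        congrFun (congrArg Subtype.val hR) u
      rw [this]
      abel
    refine ⟨R, ?_, ?_⟩
    · rw [hR', h3]
    · rw [hR', h4, ← add_assoc]
  choose R hR0 hR1 using hR
  have k1 : R 2 + G' 2 = R 0 := by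
    refine hP.sections_ext (vertex 1) ?_
    rw [hR1, hR0] at e1
    have := cotPt_section_eq (σ := σ.comp h) (v := vertex 1)
      (p := fun w => (R 2).1 w - ζ w + b' w + (G' 2).1 w)
      (q := fun w => (R 0).1 w - ζ w + b' w) e1 (face_vertex _ _) (face_vertex _ _)
    beta_reduce at this
    change (R 2).1 (vertex 1) + (G' 2).1 (vertex 1) = (R 0).1 (vertex 1)
    have h5 := congrArg (fun v => v - b' (vertex 1) + ζ (vertex 1)) this
    beta_reduce at h5
    rw [add_sub_cancel_right, sub_add_cancel] at h5
    rw [← h5]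
    abel
  have k2 : R 0 + G' 0 = R 1 + G' 1 := by
    refine hP.sections_ext (vertex 2) ?_
    rw [hR1, hR1] at e2
    have := cotPt_section_eq (σ := σ.comp h) (v := vertex 2)
      (p := fun w => (R 0).1 w - ζ w + b' w + (G' 0).1 w)
      (q := fun w => (R 1).1 w - ζ w + b' w + (G' 1).1 w) e2
      (face_vertex _ _) (face_vertex _ _)
    beta_reduce at this
    change (R 0).1 (vertex 2) + (G' 0).1 (vertex 2) =
      (R 1).1 (vertex 2) + (G' 1).1 (vertex 2)
    have h5 := congrArg (fun v => v - b' (vertex 2) + ζ (vertex 2)) this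
    beta_reduce at h5
    convert h5 using 1 <;> abel
  have k3 : R 1 = R 2 + c (σ.comp h) := by
    refine hP.sections_ext (vertex 0) ?_
    rw [hR0, hR0] at e3
    have := cotPt_section_eq (σ := σ.comp h) (v := vertex 0)
      (p := fun w => (R 1).1 w - ζ w + b' w)
      (q := fun w => (R 2).1 w - ζ w + b' w + (c (σ.comp h)).1 w) e3
      (face_vertex _ _) (face_vertex _ _)
    beta_reduce at this
    change (R 1).1 (vertex 0) = (R 2).1 (vertex 0) + (c (σ.comp h)).1 (vertex 0)
    have h5 := congrArg (fun v => v - b' (vertex 0) + ζ (vertex 0)) this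
    beta_reduce at h5
    convert h5 using 1 <;> abel
  change c (σ.comp h) = G' 0 - G' 1 +
    G' 2
  rw [← k1, k3] at k2
  have h6 := congrArg (fun v => v - R 2 - G' 1) k2
  beta_reduce at h6
  calc c (σ.comp h) = R 2 + c (σ.comp h) + G' 1 - R 2 -
        G' 1 := by abel
    _ = _ := by rw [← h6]; abel

/-- Every section over the `1`-skeleton has an obstruction cochain. -/
theorem IsLattice.exists_isObstructionCochain (hP : IsLattice k P) (s : SectionOnOneSkeleton A) :
    ∃ c : Cochain P 2, IsObstructionCochain s c := by
  have : ∀ σ : C(Simplex 2, B), ∃ c : Sections P σ, ∃ t : C(Simplex 2, E),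
      ∃ b G, IsHolonomy s σ t b G ∧ c = G (face 0) - G (face 1) + G (face 2) := by
    intro σ
    obtain ⟨t, ht⟩ := exists_lift hP A σ
    obtain ⟨b, G, h⟩ := hP.exists_isHolonomy s (hP.hasExtensions σ) t ht
    exact ⟨_, t, b, G, h, rfl⟩
  choose c t b G hG hc using this
  refine ⟨c, fun σ => ⟨t σ, fun y => ((hG σ).base y).proj_left, ?_⟩⟩
  choose ξ h1 h2 h3 h4 using fun i : Fin 3 => (hG σ).edge (face i)
  -- Corrections that join the three edge lifts into one path `v₀ → v₁ → v₂ → v₀`: each is the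
  -- holonomy accumulated so far, and `o 1`, left over on return to `v₀`, is the value of the
  -- cochain.
  obtain ⟨o, o0, o1, o2⟩ : ∃ o : Fin 3 → Sections P σ, o 0 = G σ (face 2) ∧
      o 1 = G σ (face 2) + G σ (face 0) - G σ (face 1) ∧ o 2 = 0 :=
    ⟨![G σ (face 2), G σ (face 2) + G σ (face 0) - G σ (face 1), 0], rfl, rfl, rfl⟩
  refine ⟨fun i u => ξ i u + (o i).1 (face i u),
    fun i => continuous_add (h1 i) ((o i).2.2.comp (face i).continuous), fun i u => ?_, ?_, ?_, ?_⟩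
  · exact (isShift_iff _).1 ((h2 i u).add_mem ((o i).2.1 _))
  · beta_reduce
    rw [h4, h3, o0, o2]
    have := cotPt_congr (fun w => b σ w + (G σ (face 2)).1 w)
      (show (face 2 (vertex 1) : Simplex 2) = face 0 (vertex 0) by
        rw [face_vertex, face_vertex]; rfl)
    convert this using 2
    exact add_zero _
  · beta_reduce
    rw [h4, h4, o0, o1]
    have := cotPt_congr (fun w => b σ w + (G σ (face 0)).1 w + (G σ (face 2)).1 w)
      (show (face 0 (vertex 1) : Simplex 2) = face 1 (vertex 1) by
        rw [face_vertex, face_vertex]; rfl)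
    refine this.trans (congrArg cotPt ?_)
    rw [sections_sub_apply, sections_add_apply]
    abel
  · beta_reduce
    rw [h3, h3, hc, o1, o2]
    have := cotPt_congr (fun w => b σ w + ((G σ (face 2)).1 w + (G σ (face 0)).1 w -
        (G σ (face 1)).1 w)) (show (face 1 (vertex 0) : Simplex 2) = face 2 (vertex 0) by
        rw [face_vertex, face_vertex]; rfl)
    refine this.trans (congrArg cotPt ?_)
    rw [sections_zero_apply, sections_add_apply, sections_sub_apply]
    abel

/-- Obstruction cochains are cocycles. -/
theorem IsLattice.isCoboundary_zero (hP : IsLattice k P) {s : SectionOnOneSkeleton A}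
    {c : Cochain P 2} (hc : IsObstructionCochain s c) : IsCoboundary c 0 := by
  intro τ
  obtain ⟨t, ht⟩ := exists_lift hP A τ
  obtain ⟨b, G, hG⟩ := hP.exists_isHolonomy s (hP.hasExtensions τ) t ht
  -- The holonomies are sections over all of `Δ³`, so they provide the required extensions; in the
  -- alternating sum the twelve terms cancel in pairs, one pair for each edge.
  refine ⟨fun l => G ((face l).comp (face 0)) - G ((face l).comp (face 1)) +
    G ((face l).comp (face 2)), fun l => (hG.obstruction_eq hP hc (face l)).symm, ?_⟩
  have f1 : (face 1 : C(Simplex 2, Simplex 3)).comp (face 0) = (face 0).comp (face 0) :=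
    face_comp_face (by decide)
  have f2 : (face 2 : C(Simplex 2, Simplex 3)).comp (face 0) = (face 0).comp (face 1) :=
    face_comp_face (by decide)
  have f3 : (face 3 : C(Simplex 2, Simplex 3)).comp (face 0) = (face 0).comp (face 2) :=
    face_comp_face (by decide)
  have f4 : (face 2 : C(Simplex 2, Simplex 3)).comp (face 1) = (face 1).comp (face 1) :=
    face_comp_face (by decide)
  have f5 : (face 3 : C(Simplex 2, Simplex 3)).comp (face 1) = (face 1).comp (face 2) :=
    face_comp_face (by decide)
  have f6 : (face 3 : C(Simplex 2, Simplex 3)).comp (face 2) = (face 2).comp (face 2) :=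
    face_comp_face (by decide)
  rw [alternating_sum_four]
  change 0 = _
  rw [f1, f2, f3, f4, f5, f6]
  abel

/-- The obstruction cochains of two sections differ by a coboundary. -/
theorem IsLattice.exists_isCoboundary_sub (hP : IsLattice k P) {s s' : SectionOnOneSkeleton A}
    {c c' : Cochain P 2} (hc : IsObstructionCochain s c) (hc' : IsObstructionCochain s' c') :
    ∃ g : Cochain P 1, IsCoboundary g (c' - c) := by
  choose d hd using fun x => exists_isShift (s.proj_pt x) (s'.proj_pt x)
  -- The cochain `g` records by how much the continuous difference of the two lifts of `γ`, started
  -- at `d`, misses `d` at the other end.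
  have : ∀ γ : C(Simplex 1, B), ∃ g : Sections P γ, ∃ η : ∀ u, Cot n (γ u),
      Continuous (fun u => cotPt (η u)) ∧ (∀ u, A.IsShift (η u) (s.edge γ u) (s'.edge γ u)) ∧
      η (vertex 0) = d (γ (vertex 0)) ∧ η (vertex 1) = d (γ (vertex 1)) + g.1 (vertex 1) := by
    intro γ
    have hv : ∀ i, A.IsShift (d (γ (vertex i))) (s.edge γ (vertex i)) (s'.edge γ (vertex i)) :=
      fun i => by
        rw [s.edge_vertex, s'.edge_vertex]
        exact hd _
    obtain ⟨η, h1, h2, h3⟩ := exists_covector_lift_of_eq hP (σ := γ) (s.edge γ) (s'.edge γ)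
      (fun u => s.proj_edge _ _) (fun u => s'.proj_edge _ _) (vertex 0) (hv 0)
    obtain ⟨g, hg⟩ := hP.exists_section γ (vertex 1) ((h2 (vertex 1)).sub_mem (hv 1))
    exact ⟨g, η, h1, h2, h3, by rw [hg, add_sub_cancel]⟩
  choose g η h1 h2 h3 h4 using this
  refine ⟨g, fun σ => ?_⟩
  obtain ⟨t, ht⟩ := exists_lift hP A σ
  obtain ⟨b, G, hG⟩ := hP.exists_isHolonomy s (hP.hasExtensions σ) t ht
  choose q hq using fun e : C(Simplex 1, Simplex 2) =>
    hP.exists_restrict_eq (hP.hasExtensions σ) e (g (σ.comp e))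
  -- Passing from `s` to `s'` replaces `b` by `b + d` and `G` by `G + g`. The formula for the
  -- obstruction is additive in `G`, whence `c' - c = δg`.
  have hG' : IsHolonomy s' σ t (fun y => b y + d (σ y)) (fun e => G e + q e) := by
    refine ⟨fun y => (hG.base y).trans (hd _), fun e => ?_⟩
    obtain ⟨ξ, k1, k2, k3, k4⟩ := hG.edge e
    have h1' : Continuous (fun u => (cotPt (η (σ.comp e) u : Cot n (σ (e u))))) := h1 _
    let η' : ∀ u, Cot n (σ (e u)) := η (σ.comp e)
    refine ⟨fun u => ξ u + η' u, continuous_add k1 h1', fun u => (k2 u).trans (h2 _ u), ?_, ?_⟩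
    · exact congrArg₂ _ k3 (h3 _)
    · have : (g (σ.comp e)).1 (vertex 1) = (q e).1 (e (vertex 1)) :=
        (congrFun (congrArg Subtype.val (hq e)) (vertex 1)).symm
      refine (congrArg₂ _ k4 ((h4 _).trans (congrArg _ this))).trans ?_
      exact add_add_add_comm _ _ _ _
  refine ⟨fun i => q (face i), fun i => hq _, ?_⟩
  have e1 := hG.obstruction_eq hP hc (ContinuousMap.id _)
  have e2 := hG'.obstruction_eq hP hc' (ContinuousMap.id _)
  change c σ = G (face 0) - G (face 1) + G (face 2) at e1
  change c' σ = (G (face 0) + q (face 0)) - (G (face 1) + q (face 1)) +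
    (G (face 2) + q (face 2)) at e2
  rw [Pi.sub_apply, e1, e2]
  rw [alternating_sum_three]
  abel

/-- Every affine fibration has a section over the `1`-skeleton. -/
theorem IsLattice.exists_sectionOnOneSkeleton (hP : IsLattice k P) (A : AffineFibration P E) :
    Nonempty (SectionOnOneSkeleton A) := by
  choose pt hpt using fun x => exists_point A x
  have : ∀ γ : C(Simplex 1, B), ∃ t : C(Simplex 1, E), (∀ u, A.proj (t u) = γ u) ∧
      ∀ i, t (vertex i) = pt (γ (vertex i)) := by
    intro γ
    obtain ⟨t, ht⟩ := exists_lift hP A γ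
    choose a ha using fun u => exists_isShift (ht u) (hpt (γ u))
    have hfin : (range (vertex : Fin 2 → Simplex 1)).Finite := finite_range _
    -- A finite set is discrete, so the arbitrary covectors that correct the end points of `t` form
    -- a continuous field there and extend over the edge.
    have hco : ContinuousOn (fun u => cotPt (a u)) (range (vertex : Fin 2 → Simplex 1)) :=
      hfin.continuousOn _
    obtain ⟨ξ, hξ, he⟩ := exists_covector_extension γ hfin.isClosed hco
    refine ⟨⟨fun u => A.shift (ξ u) (t u) (ht u), ?_⟩, fun u => ?_, fun i => ?_⟩
    · rw [← continuousOn_univ]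
      exact continuousOn_of_isShift t.continuous.continuousOn hξ.continuousOn
        fun u _ => ⟨ht u, rfl⟩
    · exact IsShift.proj_right ⟨ht u, rfl⟩
    · refine IsShift.unique (A := A) ⟨ht _, rfl⟩ (v := ξ (vertex i)) ?_
      rw [he _ ⟨i, rfl⟩]
      exact ha _
  choose edge h1 h2 using this
  exact ⟨⟨pt, hpt, edge, h1, h2⟩⟩

end Holonomy

end LatticeFibration

namespace LatticeFibration

/-! ### Equivalences from compatible, possibly discontinuous, sections -/

namespace AffineFibration

variable {n k : ℕ} {B : Type*} [TopologicalSpace B] [ChartedSpace (EuclideanSpace ℝ (Fin n)) B]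
  [IsManifold (𝓡 n) ∞ B] {P : ∀ x : B, AddSubgroup (Cot n x)}
  {E : Type*} [TopologicalSpace E] [ChartedSpace (EuclideanSpace ℝ (Fin (2 * n))) E]
  {E' : Type*} [TopologicalSpace E'] [ChartedSpace (EuclideanSpace ℝ (Fin (2 * n))) E']
  {A : AffineFibration P E} {A' : AffineFibration P E'}

/-- An equivalence carries obstruction cochains to obstruction cochains. -/
theorem Equivalent.exists_isObstructionCochain (h : A.Equivalent A') (s : SectionOnOneSkeleton A) :
    ∃ s' : SectionOnOneSkeleton A', ∀ c, IsObstructionCochain s c → IsObstructionCochain s' c := by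
  obtain ⟨f, hf, hact⟩ := h
  have hproj : ∀ z x, A.proj z = x → A'.proj (f z) = x := fun z x hz => hf x ⟨z, hz⟩
  let F : C(E, E') := ⟨f, f.continuous⟩
  refine ⟨⟨fun x => f (s.pt x), fun x => hproj _ _ (s.proj_pt x), fun γ => F.comp (s.edge γ),
    fun γ u => hproj _ _ (s.proj_edge γ u), fun γ i => congrArg f (s.edge_vertex γ i)⟩, ?_⟩
  intro c hc σ
  obtain ⟨t, ht, ξ, h1, h2, h3⟩ := hc σ
  -- By equivariance the same covectors `ξ`, hence the same cochain, serve for the image section.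
  refine ⟨F.comp t, fun y => hproj _ _ (ht y), ξ, h1, fun i u => ?_, h3⟩
  change f (s.edge (σ.comp (face i)) u) = _
  rw [h2]
  exact hact _ _ ⟨_, ht (face i u)⟩

/-- Adding a smooth form is a smooth map of the cotangent bundle. -/
theorem contMDiffAt_add_form {F : ∀ x : B, Cot n x} {U : Set B} (hU : IsOpen U)
    (hF : SmoothFormOn F U) {ξ₀ : CotBundle n B} (hξ₀ : ξ₀.proj ∈ U) :
    ContMDiffAt (cotI n) (cotI n) ∞ (fun ξ : CotBundle n B => cotPt (ξ.2 + F ξ.proj)) ξ₀ := by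
  have hpr : ContMDiffAt (cotI n) (𝓡 n) ∞ (fun ξ : CotBundle n B => ξ.proj) ξ₀ :=
    (contMDiff_proj (fun x : B => Cot n x)).contMDiffAt
  rw [contMDiffAt_totalSpace]
  refine ⟨hpr, ?_⟩
  have h1 := (contMDiffAt_totalSpace.1
    (contMDiffAt_id : ContMDiffAt (cotI n) (cotI n) ∞ (id : CotBundle n B → CotBundle n B) ξ₀)).2
  have h2 := (contMDiffAt_section _).1 (hF.contMDiffAt (hU.mem_nhds hξ₀))
  have h3 := ContMDiffAt.comp ξ₀ h2 hpr
  refine (h1.add h3).congr_of_eventuallyEq ?_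
  filter_upwards [hpr.continuousAt.eventually (cotTriv_mem_nhds
    (mem_cotTriv_self (n := n) ξ₀.proj))] with ξ hξ
  have hξ' := cotCoord_apply (n := n) hξ
  change ((cotTriv ξ₀.proj) (cotPt (ξ.2 + F ξ.proj))).2 =
    ((cotTriv ξ₀.proj) (cotPt ξ.2)).2 + ((cotTriv ξ₀.proj) (cotPt (F ξ.proj))).2
  rw [← hξ', ← hξ', ← hξ', map_add]

/-- The fibrewise equivariant map with given values `q` along the section `p`. -/
theorem exists_equivariant_map {p : B → E} {q : B → E'} (hp : ∀ x, A.proj (p x) = x)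
    (hq : ∀ x, A'.proj (q x) = x) :
    ∃ f : E → E', ∀ (x : B) (v : Cot n x) (z : E), A.IsShift v (p x) z →
      A'.IsShift v (q x) (f z) := by
  choose v hv using fun z => exists_isShift (hp (A.proj z)) (rfl : A.proj z = A.proj z)
  refine ⟨fun z => A'.shift (v z) (q (A.proj z)) (hq _), fun x w z hw => ?_⟩
  obtain rfl := hw.proj_right
  have hs : A'.IsShift (v z) (q (A.proj z)) (A'.shift (v z) (q (A.proj z)) (hq _)) := ⟨hq _, rfl⟩
  simpa using hs.add_mem (hw.sub_mem (hv z))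

/-- The sections `p` of `E` and `q` of `E'`, not assumed continuous, differ from smooth sections
by the same covectors, locally. -/
def Compatible (A : AffineFibration P E) (A' : AffineFibration P E') (p : B → E) (q : B → E') :
    Prop :=
  ∀ x₀ : B, ∃ U Φ Φ', x₀ ∈ U ∧ A.IsTrivializedBy U Φ ∧ A'.IsTrivializedBy U Φ' ∧
    ∃ F : ∀ x : B, Cot n x, SmoothFormOn F U ∧ ∀ x ∈ U, ∃ a : Cot n x,
      A.IsShift a (Φ (cotPt (0 : Cot n x))) (p x) ∧ A'.IsShift a (Φ' (cotPt (F x))) (q x)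

/-- Moving both local sections by `-F` exchanges the roles; the common covector becomes `F + a`. -/
theorem Compatible.symm {p : B → E} {q : B → E'} (h : Compatible A A' p q) :
    Compatible A' A q p := by
  intro x₀
  obtain ⟨U, Φ, Φ', hx, hΦ, hΦ', F, hF, ha⟩ := h x₀
  refine ⟨U, Φ', Φ, hx, hΦ', hΦ, fun x => -F x, ContMDiffOn.neg_section hF, fun x hxU => ?_⟩
  obtain ⟨a, h1, h2⟩ := ha x hxU
  refine ⟨F x + a, ?_, ?_⟩
  · have := (hΦ'.isShift_sub hxU (F x) 0).trans h2
    rwa [sub_zero] at this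
  · have := (hΦ.isShift_sub hxU 0 (-F x)).trans h1
    rwa [zero_sub, neg_neg] at this

/-- The covectors `a`, of which no continuity is known, cancel: `f` takes `Φ(0)` to `Φ'(F)`, so
locally it is a smooth inverse of `Φ`, followed by addition of `F`, followed by `Φ'`. -/
theorem Compatible.contMDiff {p : B → E} {q : B → E'} (h : Compatible A A' p q) {f : E → E'}
    (hf : ∀ (x : B) (v : Cot n x) (z : E), A.IsShift v (p x) z → A'.IsShift v (q x) (f z)) :
    ContMDiff (𝓡 (2 * n)) (𝓡 (2 * n)) ∞ f := by
  intro z₀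
  obtain ⟨U, Φ, Φ', hx, hΦ, hΦ', F, hF, ha⟩ := h (A.proj z₀)
  obtain ⟨Ψ, W, hW, hzW, hΨ, hev⟩ := hΦ.exists_local_inverse hx
  have key : ∀ z ∈ W, f z = Φ' (cotPt ((Ψ z).2 + F (Ψ z).proj)) := by
    intro z hz
    obtain ⟨h1, h2, h3⟩ := hev z hz
    have hU : (Ψ z).proj ∈ U := h1 ▸ h2
    obtain ⟨a, ha1, ha2⟩ := ha _ hU
    have e1 := hΦ.isShift_sub hU (Ψ z).2 0
    rw [show cotPt (Ψ z).2 = Ψ z from rfl, h3] at e1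
    have e3 := ha2.trans (hf _ _ _ (ha1.symm.trans e1))
    rw [sub_zero, add_neg_cancel_left] at e3
    exact e3.unique (hΦ'.isShift _ hU (Ψ z).2 (F (Ψ z).proj))
  have hU₀ : (Ψ z₀).proj ∈ U := (hev z₀ hzW).1 ▸ hx
  have hΨ₀ := hΨ.contMDiffAt (hW.mem_nhds hzW)
  have hτ := (contMDiffAt_add_form hΦ.isOpen hF hU₀).comp z₀ hΨ₀
  have hfin : ContMDiffAt (𝓡 (2 * n)) (𝓡 (2 * n)) ∞
      (fun z => Φ' (cotPt ((Ψ z).2 + F (Ψ z).proj))) z₀ :=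
    ContMDiffAt.comp z₀ (g := Φ') (hΦ'.contMDiffAt (by exact hU₀)) hτ
  exact hfin.congr_of_eventuallyEq (Filter.eventually_of_mem (hW.mem_nhds hzW) key)

/-- Compatible sections give an equivalence. -/
theorem Compatible.equivalent {p : B → E} {q : B → E'} (hp : ∀ x, A.proj (p x) = x)
    (hq : ∀ x, A'.proj (q x) = x) (h : Compatible A A' p q) : A.Equivalent A' := by
  obtain ⟨f, hf⟩ := exists_equivariant_map hp hq
  obtain ⟨g, hg⟩ := exists_equivariant_map hq hp
  have hgf : ∀ z, g (f z) = z := fun z => by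
    obtain ⟨v, hv⟩ := exists_isShift (hp (A.proj z)) (rfl : A.proj z = A.proj z)
    exact (hg _ _ _ (hf _ _ _ hv)).unique hv
  have hfg : ∀ z, f (g z) = z := fun z => by
    obtain ⟨v, hv⟩ := exists_isShift (hq (A'.proj z)) (rfl : A'.proj z = A'.proj z)
    exact (hf _ _ _ (hg _ _ _ hv)).unique hv
  refine ⟨⟨⟨f, g, hgf, hfg⟩, h.contMDiff hf, h.symm.contMDiff hg⟩, fun x z => ?_, fun x a z => ?_⟩
  · obtain ⟨v, hv⟩ := exists_isShift (hp x) z.2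
    exact (hf _ _ _ hv).proj_right
  · obtain ⟨w, rfl⟩ := QuotientAddGroup.mk_surjective a
    obtain ⟨v, hv⟩ := exists_isShift (hp x) z.2
    have h1 := hf _ _ _ (hv.trans (isShift_vadd (v := w)))
    have h2 := hf _ _ _ hv
    exact h1.unique (h2.trans ⟨h2.proj_right, rfl⟩)

end AffineFibration

end LatticeFibration

namespace LatticeFibration

/-! ### Star-shaped neighbourhoods and cones over paths -/

section Star

theorem face_apply_succAbove {k : ℕ} (i : Fin (k + 2)) (u : Simplex k) (j : Fin (k + 1)) :
    face i u (i.succAbove j) = u j := by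
  simp only [face, ContinuousMap.coe_mk, stdSimplex.map_coe, FunOnFinite.linearMap_apply_apply]
  rw [Finset.sum_eq_single j]
  · intro l hl hne
    simp only [Finset.mem_filter, Finset.mem_univ, true_and] at hl
    exact (hne (Fin.succAbove_right_injective hl)).elim
  · intro h
    simp at h

theorem face_apply_self {k : ℕ} (i : Fin (k + 2)) (u : Simplex k) : face i u i = 0 := by
  simp only [face, ContinuousMap.coe_mk, stdSimplex.map_coe, FunOnFinite.linearMap_apply_apply]
  refine Finset.sum_eq_zero fun l hl => ?_
  simp only [Finset.mem_filter, Finset.mem_univ, true_and] at hl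
  exact (Fin.succAbove_ne i l hl).elim

theorem vertex_apply_self {k : ℕ} (i : Fin (k + 1)) : (vertex i : Simplex k) i = 1 := by
  simp [vertex]

theorem vertex_apply_of_ne {k : ℕ} {i j : Fin (k + 1)} (h : j ≠ i) :
    (vertex i : Simplex k) j = 0 := by
  simp [vertex, h]

/-- `X` is star-shaped about `c`: there are paths `p x` from `c` to every point `x`, and cones
over all paths. -/
def IsStar {X : Type*} [TopologicalSpace X] (c : X) (p : X → C(Simplex 1, X)) : Prop :=
  (∀ x, p x (vertex 0) = c) ∧ (∀ x, p x (vertex 1) = x) ∧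
    ∀ γ : C(Simplex 1, X), ∃ h : C(Simplex 2, X), h.comp (face 0) = γ ∧
      h.comp (face 1) = p (γ (vertex 1)) ∧ h.comp (face 2) = p (γ (vertex 0))

theorem IsStar.homeomorph {X Y : Type*} [TopologicalSpace X] [TopologicalSpace Y] (e : X ≃ₜ Y)
    {c : X} {p : X → C(Simplex 1, X)} (h : IsStar c p) :
    IsStar (e c) (fun y => (e : C(X, Y)).comp (p (e.symm y))) := by
  refine ⟨fun y => congrArg e (h.1 _), fun y => ?_, fun γ => ?_⟩
  · exact (congrArg e (h.2.1 _)).trans (e.apply_symm_apply y)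
  · obtain ⟨g, h0, h1, h2⟩ := h.2.2 ((e.symm : C(Y, X)).comp γ)
    refine ⟨(e : C(X, Y)).comp g, ?_, ?_, ?_⟩
    · rw [ContinuousMap.comp_assoc, h0]
      ext u
      simp
    · rw [ContinuousMap.comp_assoc, h1]
      rfl
    · rw [ContinuousMap.comp_assoc, h2]
      rfl

theorem IsStar.preconnectedSpace {X : Type*} [TopologicalSpace X] {c : X}
    {p : X → C(Simplex 1, X)} (h : IsStar c p) : PreconnectedSpace X := by
  constructor
  refine isPreconnected_of_forall c fun x _ => ⟨range (p x), subset_univ _, ⟨_, h.1 x⟩,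
    ⟨_, h.2.1 x⟩, isPreconnected_range (p x).continuous⟩

/-- Straight segments from the centre, and the straight cone over each path. -/
theorem exists_isStar_ball {W : Type*} [NormedAddCommGroup W] [NormedSpace ℝ W] (c : W) {r : ℝ}
    (hr : 0 < r) : ∃ p, IsStar (⟨c, Metric.mem_ball_self hr⟩ : Metric.ball c r) p := by
  have hmem : ∀ (s : ℝ) (x : Metric.ball c r), 0 ≤ s → s ≤ 1 →
      c + s • ((x : W) - c) ∈ Metric.ball c r := by
    intro s x h0 h1
    have hx := x.2
    rw [Metric.mem_ball, dist_eq_norm] at hx ⊢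
    rw [add_sub_cancel_left, norm_smul, Real.norm_of_nonneg h0]
    exact (mul_le_of_le_one_left (norm_nonneg _) h1).trans_lt hx
  have hcoord : ∀ {k : ℕ} (i : Fin (k + 1)), Continuous fun y : Simplex k => y i := fun i =>
    (continuous_apply i).comp continuous_subtype_val
  let p : Metric.ball c r → C(Simplex 1, Metric.ball c r) := fun x =>
    ⟨fun u => ⟨c + u 1 • ((x : W) - c), hmem _ x (stdSimplex.zero_le u 1) (stdSimplex.le_one u 1)⟩,
      Continuous.subtype_mk (continuous_const.add ((hcoord 1).smul continuous_const)) _⟩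
  have p_apply : ∀ x u, (p x u : W) = c + u 1 • ((x : W) - c) := fun _ _ => rfl
  refine ⟨p, fun x => Subtype.ext ?_, fun x => Subtype.ext ?_, fun γ => ?_⟩
  · rw [p_apply, vertex_apply_of_ne (by decide)]
    simp
  · rw [p_apply, vertex_apply_self]
    simp
  · let Γ : ℝ → W := fun s =>
      γ (stdSimplexHomeomorphUnitInterval.symm (projIcc 0 1 zero_le_one s))
    have hΓ : Continuous Γ := continuous_subtype_val.comp (γ.continuous.comp
      (stdSimplexHomeomorphUnitInterval.symm.continuous.comp continuous_projIcc))
    have hΓu : ∀ u : Simplex 1, Γ (u 1) = γ u := by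
      intro u
      have : projIcc 0 1 zero_le_one (u 1) = stdSimplexHomeomorphUnitInterval u :=
        projIcc_of_mem zero_le_one (stdSimplexHomeomorphUnitInterval u).2
      simp only [Γ, this, Homeomorph.symm_apply_apply]
    have hΓ0 : Γ 0 = γ (vertex 0) := by
      rw [← hΓu, vertex_apply_of_ne (by decide)]
    have hΓ1 : Γ 1 = γ (vertex 1) := by
      rw [← hΓu, vertex_apply_self]
    have hΓr : ∀ s, ‖Γ s - c‖ ≤ r := fun s => by
      have := (γ (stdSimplexHomeomorphUnitInterval.symm (projIcc 0 1 zero_le_one s))).2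
      rw [Metric.mem_ball, dist_eq_norm] at this
      exact this.le
    -- `y 2 / (y 1 + y 2)` is the parameter on the face opposite the cone point and `y 1 + y 2` the
    -- radial factor. At the cone point the quotient is the default `0 / 0 = 0`; continuity holds
    -- there since the factor tends to 0 and `Γ` is bounded.
    let H : Simplex 2 → W := fun y => c + (y 1 + y 2) • (Γ (y 2 / (y 1 + y 2)) - c)
    have hsum : ∀ y : Simplex 2, 0 ≤ y 1 + y 2 ∧ y 1 + y 2 ≤ 1 := by
      intro y
      have h0 := stdSimplex.sum_eq_one y
      rw [Fin.sum_univ_three] at h0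
      have := stdSimplex.zero_le y 0
      have := stdSimplex.zero_le y 1
      have := stdSimplex.zero_le y 2
      constructor <;> linarith
    have hH : Continuous H := by
      have hs : Continuous fun y : Simplex 2 => y 1 + y 2 := (hcoord 1).add (hcoord 2)
      rw [continuous_iff_continuousAt]
      intro y
      refine continuousAt_const.add ?_
      by_cases hy : y 1 + y 2 = 0
      · have h0 : Filter.Tendsto (fun y : Simplex 2 => (y 1 + y 2) * r) (𝓝 y) (𝓝 0) := by
          have := (hs.tendsto y).mul_const r
          rwa [hy, zero_mul] at this
        unfold ContinuousAt
        beta_reduce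
        rw [hy, zero_smul]
        refine squeeze_zero_norm (fun z => ?_) h0
        rw [norm_smul, Real.norm_of_nonneg (hsum z).1]
        exact mul_le_mul_of_nonneg_left (hΓr _) (hsum z).1
      · exact hs.continuousAt.smul ((hΓ.continuousAt.comp
          ((hcoord 2).continuousAt.div hs.continuousAt hy)).sub continuousAt_const)
    let h : C(Simplex 2, Metric.ball c r) :=
      ⟨fun y => ⟨H y, hmem _ _ (hsum y).1 (hsum y).2⟩, hH.subtype_mk _⟩
    have h_apply : ∀ y, (h y : W) = c + (y 1 + y 2) • (Γ (y 2 / (y 1 + y 2)) - c) :=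
      fun _ => rfl
    refine ⟨h, ?_, ?_, ?_⟩
    · ext1 u
      apply Subtype.ext
      have h1 : face 0 u 1 = u 0 := face_apply_succAbove 0 u 0
      have h2 : face 0 u 2 = u 1 := face_apply_succAbove 0 u 1
      have h3 := stdSimplex.add_eq_one u
      rw [ContinuousMap.comp_apply, h_apply, h1, h2, h3, div_one, hΓu, one_smul, add_sub_cancel]
    · ext1 u
      apply Subtype.ext
      have h1 : face 1 u 1 = 0 := face_apply_self 1 u
      have h2 : face 1 u 2 = u 1 := face_apply_succAbove 1 u 1
      rw [ContinuousMap.comp_apply, h_apply, h1, h2, zero_add, p_apply]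
      by_cases hu : u 1 = 0
      · rw [hu, zero_smul, zero_smul]
      · rw [div_self hu, hΓ1]
    · ext1 u
      apply Subtype.ext
      have h1 : face 2 u 1 = u 1 := face_apply_succAbove 2 u 1
      have h2 : face 2 u 2 = 0 := face_apply_self 2 u
      rw [ContinuousMap.comp_apply, h_apply, h1, h2, zero_div, add_zero, p_apply, hΓ0]

/-- Every point of a manifold has arbitrarily small star-shaped neighbourhoods. -/
theorem exists_isStar_nhds {W B : Type*} [NormedAddCommGroup W] [NormedSpace ℝ W]
    [TopologicalSpace B] [ChartedSpace W B] (x₀ : B) {U : Set B} (hU : IsOpen U) (hx₀ : x₀ ∈ U) :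
    ∃ V : Set B, IsOpen V ∧ V ⊆ U ∧ ∃ hx : x₀ ∈ V, ∃ p, IsStar (⟨x₀, hx⟩ : V) p := by
  let φ := (chartAt W x₀).restrOpen U hU
  have hxφ : x₀ ∈ φ.source := by
    rw [OpenPartialHomeomorph.restrOpen_source]
    exact ⟨mem_chart_source W x₀, hx₀⟩
  have hφU : φ.source ⊆ U := by
    rw [OpenPartialHomeomorph.restrOpen_source]
    exact inter_subset_right
  obtain ⟨r, hr, hball⟩ := Metric.isOpen_iff.1 φ.open_target (φ x₀) (φ.map_source hxφ)
  let ψ := φ.symm.restrOpen (Metric.ball (φ x₀) r) Metric.isOpen_ball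
  have hψ : ψ.source = Metric.ball (φ x₀) r := by
    rw [OpenPartialHomeomorph.restrOpen_source]
    exact inter_eq_right.2 hball
  obtain ⟨p, hp⟩ := exists_isStar_ball (φ x₀) hr
  let e : Metric.ball (φ x₀) r ≃ₜ ψ.target :=
    (Homeomorph.setCongr hψ.symm).trans ψ.toHomeomorphSourceTarget
  have he : (e ⟨φ x₀, Metric.mem_ball_self hr⟩ : B) = x₀ := φ.left_inv hxφ
  have hmem : x₀ ∈ ψ.target := he ▸ (e _).2
  have hex : e ⟨φ x₀, Metric.mem_ball_self hr⟩ = ⟨x₀, hmem⟩ := Subtype.ext he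
  refine ⟨ψ.target, ψ.open_target, ?_, hmem, _, hex ▸ hp.homeomorph e⟩
  intro x hx
  have h1 := ψ.map_target hx
  have h2 : ψ (ψ.symm x) = x := ψ.right_inv hx
  rw [hψ] at h1
  rw [← h2]
  exact hφU (φ.map_target (hball h1))

end Star

end LatticeFibration

namespace LatticeFibration

/-! ### Potentials: the difference of two 1-skeleton sections -/

open AffineFibration

variable {n k : ℕ} {B : Type*} [TopologicalSpace B] [ChartedSpace (EuclideanSpace ℝ (Fin n)) B]
  [IsManifold (𝓡 n) ∞ B] {P : ∀ x : B, AddSubgroup (Cot n x)}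
  {E : Type*} [TopologicalSpace E] [ChartedSpace (EuclideanSpace ℝ (Fin (2 * n))) E]
  {E' : Type*} [TopologicalSpace E'] [ChartedSpace (EuclideanSpace ℝ (Fin (2 * n))) E']
  {A : AffineFibration P E} {A' : AffineFibration P E'}

/-- The covectors `v` along `σ` measure the difference of the sections `s` and `s'` over the
`1`-skeleton, relative to the sections `t` and `t'` along `σ`, up to the cochain `ε`. -/
structure IsPotential {X : Type*} [TopologicalSpace X] (s : SectionOnOneSkeleton A)
    (s' : SectionOnOneSkeleton A') (ε : Cochain P 1) (σ : C(X, B)) (t : X → E) (t' : X → E')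
    (v : ∀ x, Cot n (σ x)) : Prop where
  point : ∀ x, ∃ a : Cot n (σ x), A.IsShift a (t x) (s.pt (σ x)) ∧
    A'.IsShift (a + v x) (t' x) (s'.pt (σ x))
  path : ∀ γ : C(Simplex 1, X), ∃ ξ ξ' : ∀ u, Cot n (σ.comp γ u),
    Continuous (fun u => cotPt (ξ u)) ∧ Continuous (fun u => cotPt (ξ' u)) ∧
    (∀ u, A.IsShift (ξ u) (t (γ u)) (s.edge (σ.comp γ) u)) ∧
    (∀ u, A'.IsShift (ξ' u) (t' (γ u)) (s'.edge (σ.comp γ) u)) ∧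
    ξ' (vertex 0) - ξ (vertex 0) = v (γ (vertex 0)) ∧
    ξ' (vertex 1) - ξ (vertex 1) + (ε (σ.comp γ)).1 (vertex 1) = v (γ (vertex 1))

/-- Since `c - c' = δε`, the cochain `D = G - G' - ε` on `X` is closed. Coning from the centre makes
it the coboundary of `x ↦ D (p x)`, and `b' - b - D (p x)` is the potential. -/
theorem IsLattice.exists_isPotential (hP : IsLattice k P) {s : SectionOnOneSkeleton A}
    {s' : SectionOnOneSkeleton A'} {c c' : Cochain P 2} (hc : IsObstructionCochain s c)
    (hc' : IsObstructionCochain s' c') {ε : Cochain P 1} (hε : IsCoboundary ε (c - c'))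
    {X : Type*} [TopologicalSpace X] {σ : C(X, B)} (hσ : HasExtensions P σ) {x₀ : X}
    {p : X → C(Simplex 1, X)} (hp : IsStar x₀ p) (t : C(X, E)) (ht : ∀ x, A.proj (t x) = σ x)
    (t' : C(X, E')) (ht' : ∀ x, A'.proj (t' x) = σ x) :
    ∃ v, IsPotential s s' ε σ t t' v := by
  have : PreconnectedSpace X := hp.preconnectedSpace
  obtain ⟨b, G, hG⟩ := hP.exists_isHolonomy s hσ t ht
  obtain ⟨b', G', hG'⟩ := hP.exists_isHolonomy s' hσ t' ht'
  choose q hq using fun e : C(Simplex 1, X) => hP.exists_restrict_eq hσ e (ε (σ.comp e))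
  let D : C(Simplex 1, X) → Sections P σ := fun e => G e - G' e - q e
  have hD : ∀ h : C(Simplex 2, X),
      D (h.comp (face 0)) - D (h.comp (face 1)) + D (h.comp (face 2)) = 0 := by
    intro h
    refine restrict_injective hP h ?_
    obtain ⟨r, hr, hcr⟩ := hε (σ.comp h)
    have hr' : ∀ i : Fin 3, r i = restrict (q (h.comp (face i))) h := fun i =>
      restrict_injective hP (face i) ((hr i).trans (hq (h.comp (face i))).symm)
    rw [alternating_sum_three, hr', hr', hr', Pi.sub_apply, hG.obstruction_eq hP hc h,
      hG'.obstruction_eq hP hc' h] at hcr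
    have hcr' : restrict (G (h.comp (face 0)) - G (h.comp (face 1)) + G (h.comp (face 2)) -
        (G' (h.comp (face 0)) - G' (h.comp (face 1)) + G' (h.comp (face 2)))) h =
        restrict (q (h.comp (face 0)) - q (h.comp (face 1)) + q (h.comp (face 2))) h := hcr
    have h2 := restrict_injective hP h hcr'
    have h3 : D (h.comp (face 0)) - D (h.comp (face 1)) + D (h.comp (face 2)) =
        G (h.comp (face 0)) - G (h.comp (face 1)) + G (h.comp (face 2)) -
        (G' (h.comp (face 0)) - G' (h.comp (face 1)) + G' (h.comp (face 2))) -
        (q (h.comp (face 0)) - q (h.comp (face 1)) + q (h.comp (face 2))) := by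
      simp only [D]
      abel
    rw [h3, h2, sub_self]
  -- Closedness of `D` on the cone over `γ`.
  have hDp : ∀ γ : C(Simplex 1, X), D γ = D (p (γ (vertex 1))) - D (p (γ (vertex 0))) := by
    intro γ
    obtain ⟨h, h0, h1, h2⟩ := hp.2.2 γ
    have := hD h
    rw [h0, h1, h2] at this
    rw [← sub_eq_zero, ← this]
    abel
  refine ⟨fun x => b' x - b x - (D (p x)).1 x, fun x => ⟨b x, hG.base x, ?_⟩, fun γ => ?_⟩
  · have := (hG'.base x).add_mem (neg_mem ((D (p x)).2.1 x))
    convert this using 1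
    abel
  · obtain ⟨ξ, h1, h2, h3, h4⟩ : ∃ ξ : ∀ u, Cot n (σ.comp γ u),
        Continuous (fun u => cotPt (ξ u)) ∧
        (∀ u, A.IsShift (ξ u) (t (γ u)) (s.edge (σ.comp γ) u)) ∧
        ξ (vertex 0) = b (γ (vertex 0)) ∧
        ξ (vertex 1) = b (γ (vertex 1)) + (G γ).1 (γ (vertex 1)) := hG.edge γ
    obtain ⟨ξ', h1', h2', h3', h4'⟩ : ∃ ξ : ∀ u, Cot n (σ.comp γ u),
        Continuous (fun u => cotPt (ξ u)) ∧
        (∀ u, A'.IsShift (ξ u) (t' (γ u)) (s'.edge (σ.comp γ) u)) ∧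
        ξ (vertex 0) = b' (γ (vertex 0)) ∧
        ξ (vertex 1) = b' (γ (vertex 1)) + (G' γ).1 (γ (vertex 1)) := hG'.edge γ
    -- Subtracting this one section along `γ` gives `ξ'` the right start; at the end, `hDp` turns
    -- it, with the holonomies and `ε`, into `D (p (γ 1))`.
    let w : Sections P (σ.comp γ) := restrict (D (p (γ (vertex 0)))) γ
    refine ⟨ξ, fun u => ξ' u - w.1 u, h1, continuous_sub_lift h1' w.2.2, h2, fun u => ?_, ?_, ?_⟩
    · beta_reduce
      rw [sub_eq_add_neg]
      exact (h2' u).add_mem (neg_mem (w.2.1 u))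
    · beta_reduce
      rw [h3, h3']
      exact sub_right_comm _ _ _
    · have h5 : (D γ).1 (γ (vertex 1)) = (D (p (γ (vertex 1)))).1 (γ (vertex 1)) -
          (D (p (γ (vertex 0)))).1 (γ (vertex 1)) := by
        rw [hDp γ]; rfl
      have h6 : (D γ).1 (γ (vertex 1)) = (G γ).1 (γ (vertex 1)) - (G' γ).1 (γ (vertex 1)) -
          (q γ).1 (γ (vertex 1)) := rfl
      have h7 : (ε (σ.comp γ)).1 (vertex 1) = (q γ).1 (γ (vertex 1)) :=
        (congrFun (congrArg Subtype.val (hq γ)) (vertex 1)).symm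
      beta_reduce
      rw [h4, h4', h7]
      change b' (γ (vertex 1)) + (G' γ).1 (γ (vertex 1)) -
          (D (p (γ (vertex 0)))).1 (γ (vertex 1)) -
        (b (γ (vertex 1)) + (G γ).1 (γ (vertex 1))) + (q γ).1 (γ (vertex 1)) =
        b' (γ (vertex 1)) - b (γ (vertex 1)) - (D (p (γ (vertex 1)))).1 (γ (vertex 1))
      rw [h6] at h5
      have h8 := sub_eq_zero.2 h5
      rw [← sub_eq_zero, ← neg_eq_zero, ← h8]
      abel

theorem IsPotential.comp {X Y : Type*} [TopologicalSpace X] [TopologicalSpace Y]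
    {s : SectionOnOneSkeleton A} {s' : SectionOnOneSkeleton A'} {ε : Cochain P 1} {σ : C(X, B)}
    {t : X → E} {t' : X → E'} {v : ∀ x, Cot n (σ x)} (h : IsPotential s s' ε σ t t' v)
    (e : C(Y, X)) :
    IsPotential s s' ε (σ.comp e) (fun y => t (e y)) (fun y => t' (e y)) (fun y => v (e y)) :=
  ⟨fun y => h.point (e y), fun γ => h.path (e.comp γ)⟩

/-- Two potentials relative to different local sections differ by a section of `P`, up to the
difference of the local sections. -/
theorem IsPotential.exists_section {X : Type*} [TopologicalSpace X]
    {s : SectionOnOneSkeleton A} {s' : SectionOnOneSkeleton A'} {ε : Cochain P 1} {σ : C(X, B)}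
    {t₁ t₂ : X → E} {t₁' t₂' : X → E'} {v₁ v₂ : ∀ x, Cot n (σ x)}
    (h₁ : IsPotential s s' ε σ t₁ t₁' v₁) (h₂ : IsPotential s s' ε σ t₂ t₂' v₂)
    {u u' : ∀ x, Cot n (σ x)} (hu : Continuous fun x => cotPt (u x))
    (hu' : Continuous fun x => cotPt (u' x)) (ht : ∀ x, A.IsShift (u x) (t₂ x) (t₁ x))
    (ht' : ∀ x, A'.IsShift (u' x) (t₂' x) (t₁' x)) (γ : C(Simplex 1, X)) :
    ∃ r : Sections P (σ.comp γ), ∀ i, r.1 (vertex i) =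
      u' (γ (vertex i)) - u (γ (vertex i)) + v₁ (γ (vertex i)) - v₂ (γ (vertex i)) := by
  obtain ⟨ξ₁, ξ₁', c₁, c₁', s₁, s₁', a₁, b₁⟩ := h₁.path γ
  obtain ⟨ξ₂, ξ₂', c₂, c₂', s₂, s₂', a₂, b₂⟩ := h₂.path γ
  let w : ∀ y, Cot n (σ.comp γ y) := fun y => u (γ y)
  let w' : ∀ y, Cot n (σ.comp γ y) := fun y => u' (γ y)
  have hw : Continuous fun y => cotPt (w y) := hu.comp γ.continuous
  have hw' : Continuous fun y => cotPt (w' y) := hu'.comp γ.continuous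
  have m : ∀ y, w y + ξ₁ y - ξ₂ y ∈ P (σ.comp γ y) := fun y =>
    ((ht (γ y)).trans (s₁ y)).sub_mem (s₂ y)
  have m' : ∀ y, w' y + ξ₁' y - ξ₂' y ∈ P (σ.comp γ y) := fun y =>
    ((ht' (γ y)).trans (s₁' y)).sub_mem (s₂' y)
  -- Each bracket compares two shifts between the same points, so it lies in `P`. In their
  -- difference the two contributions of `ε` at the final vertex cancel.
  refine ⟨⟨fun y => (w' y + ξ₁' y - ξ₂' y) - (w y + ξ₁ y - ξ₂ y), fun y => sub_mem (m' y) (m y),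
    continuous_sub_lift (continuous_sub_lift (continuous_add hw' c₁') c₂')
      (continuous_sub_lift (continuous_add hw c₁) c₂)⟩, fun i => ?_⟩
  have key : (w' (vertex i) + ξ₁' (vertex i) - ξ₂' (vertex i)) -
      (w (vertex i) + ξ₁ (vertex i) - ξ₂ (vertex i)) = w' (vertex i) - w (vertex i) +
      (ξ₁' (vertex i) - ξ₁ (vertex i)) - (ξ₂' (vertex i) - ξ₂ (vertex i)) := by abel
  refine key.trans ?_
  fin_cases i
  · change w' (vertex 0) - w (vertex 0) +
      (ξ₁' (vertex 0) - ξ₁ (vertex 0)) - (ξ₂' (vertex 0) - ξ₂ (vertex 0)) = _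
    rw [a₁, a₂]
    rfl
  · change w' (vertex 1) - w (vertex 1) +
      (ξ₁' (vertex 1) - ξ₁ (vertex 1)) - (ξ₂' (vertex 1) - ξ₂ (vertex 1)) = _
    refine (?_ : _ = u' (γ (vertex 1)) - u (γ (vertex 1)) + v₁ (γ (vertex 1)) - v₂ (γ (vertex 1)))
    rw [← b₁, ← b₂]
    exact (by intros; abel : ∀ a b c d e : Cot n (σ (γ (vertex 1))),
      a - b + c - d = a - b + (c + e) - (d + e)) _ _ _ _ _

end LatticeFibration

namespace LatticeFibration

open AffineFibration

/-! ### Smooth differences of local potentials and the global equivalence -/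

section Potentials

variable {n k : ℕ} {B : Type*} [TopologicalSpace B] [ChartedSpace (EuclideanSpace ℝ (Fin n)) B]
  [IsManifold (𝓡 n) ∞ B] {P : ∀ x : B, AddSubgroup (Cot n x)}
  {E : Type*} [TopologicalSpace E] [ChartedSpace (EuclideanSpace ℝ (Fin (2 * n))) E]
  {E' : Type*} [TopologicalSpace E'] [ChartedSpace (EuclideanSpace ℝ (Fin (2 * n))) E']
  {A : AffineFibration P E} {A' : AffineFibration P E'}

/-- The smooth local section defined by a trivialization. -/
theorem IsTrivializedBy.contMDiffOn_zero {U : Set B} {Φ : CotBundle n B → E}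
    (hΦ : A.IsTrivializedBy U Φ) :
    ContMDiffOn (𝓡 n) (𝓡 (2 * n)) ∞ (fun x : B => Φ (cotPt (0 : Cot n x))) U := fun x hx => by
  have h0 : ContMDiffAt (𝓡 n) (cotI n) ∞ (fun x : B => cotPt (0 : Cot n x)) x :=
    (contMDiff_zeroSection ℝ (fun x : B => Cot n x)).contMDiffAt
  exact (ContMDiffAt.comp x (g := Φ) (hΦ.contMDiffAt (by exact hx)) h0).contMDiffWithinAt

/-- The smooth sections defined by two trivializations differ by a smooth form, locally. -/
theorem exists_smooth_difference {U U' : Set B} {Φ Φ' : CotBundle n B → E}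
    (hΦ : A.IsTrivializedBy U Φ) (hΦ' : A.IsTrivializedBy U' Φ') {x₀ : B} (hx : x₀ ∈ U)
    (hx' : x₀ ∈ U') : ∃ u : ∀ x : B, Cot n x, ∃ N : Set B, IsOpen N ∧ x₀ ∈ N ∧ SmoothFormOn u N ∧
      ∀ x ∈ N, A.IsShift (u x) (Φ' (cotPt (0 : Cot n x))) (Φ (cotPt (0 : Cot n x))) := by
  have hz : A.proj (Φ (cotPt (0 : Cot n x₀))) = x₀ := hΦ.proj_eq x₀ hx 0
  obtain ⟨Ψ, W, hW, hzW, hΨ, hev⟩ :=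
    hΦ'.exists_local_inverse (z₀ := Φ (cotPt (0 : Cot n x₀))) (by rwa [hz])
  have ht := IsTrivializedBy.contMDiffOn_zero hΦ
  obtain ⟨u, hu⟩ : ∃ u : ∀ x : B, Cot n x, ∀ x, (Ψ (Φ (cotPt (0 : Cot n x)))).proj = x →
    cotPt (u x) = Ψ (Φ (cotPt (0 : Cot n x))) := exists_cotPt_eq (f := id) _
  have hN : ∀ x ∈ U ∩ (fun x : B => Φ (cotPt (0 : Cot n x))) ⁻¹' W,
      x ∈ U' ∧ cotPt (u x) = Ψ (Φ (cotPt (0 : Cot n x))) ∧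
        Φ' (Ψ (Φ (cotPt (0 : Cot n x)))) = Φ (cotPt (0 : Cot n x)) := by
    rintro x ⟨hxU, hxW⟩
    obtain ⟨h1, h2, h3⟩ := hev _ hxW
    rw [hΦ.proj_eq x hxU 0] at h1 h2
    exact ⟨h2, hu x h1, h3⟩
  refine ⟨u, _, ht.continuousOn.isOpen_inter_preimage hΦ.isOpen hW, ⟨hx, hzW⟩, ?_, fun x hxN => ?_⟩
  · exact (hΨ.comp (ht.mono inter_subset_left) inter_subset_right).congr fun x hx => (hN x hx).2.1
  · obtain ⟨h1, h2, h3⟩ := hN x hxN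
    have h4 : Φ' (cotPt (u x)) = Φ (cotPt (0 : Cot n x)) := (congrArg Φ' h2).trans h3
    have h5 := hΦ'.isShift_sub h1 (u x) 0
    rw [sub_zero] at h5
    exact h4 ▸ h5

/-- The inclusion of a subset. -/
def inclusionMap (V : Set B) : C(V, B) := ⟨Subtype.val, continuous_subtype_val⟩

/-- The data of trivializations of `A` and `A'` over `V` together with a potential. -/
structure IsLocalPotential (s : SectionOnOneSkeleton A) (s' : SectionOnOneSkeleton A')
    (ε : Cochain P 1) (V : Set B) (Φ : CotBundle n B → E) (Φ' : CotBundle n B → E')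
    (v : ∀ x : B, Cot n x) : Prop where
  triv : A.IsTrivializedBy V Φ
  triv' : A'.IsTrivializedBy V Φ'
  potential : IsPotential s s' ε (inclusionMap V) (fun x => Φ (cotPt (0 : Cot n x.1)))
    (fun x => Φ' (cotPt (0 : Cot n x.1))) (fun x => v x.1)

/-- Inside the domains of both trivializations and of local extensions of lattice elements, a
star-shaped neighbourhood has no monodromy, so `exists_isPotential` applies. -/
theorem IsLattice.exists_isLocalPotential (hP : IsLattice k P) {s : SectionOnOneSkeleton A}
    {s' : SectionOnOneSkeleton A'} {c c' : Cochain P 2} (hc : IsObstructionCochain s c)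
    (hc' : IsObstructionCochain s' c') {ε : Cochain P 1} (hε : IsCoboundary ε (c - c')) (x₀ : B) :
    ∃ V Φ Φ' v, x₀ ∈ V ∧ IsLocalPotential s s' ε V Φ Φ' v := by
  classical
  obtain ⟨U₀, hU₀, hx₀, hsec⟩ := hP.exists_local_sections x₀
  obtain ⟨U, Φ, hx, hΦ⟩ := A.exists_isTrivializedBy x₀
  obtain ⟨U', Φ', hx', hΦ'⟩ := A'.exists_isTrivializedBy x₀
  obtain ⟨V, hV, hVU, hxV, p, hp⟩ := exists_isStar_nhds (W := EuclideanSpace ℝ (Fin n)) x₀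
    (hU₀.inter (hΦ.isOpen.inter hΦ'.isOpen)) ⟨hx₀, hx, hx'⟩
  have tV := hΦ.mono hV fun x h => (hVU h).2.1
  have tV' := hΦ'.mono hV fun x h => (hVU h).2.2
  have hσ : HasExtensions P (inclusionMap V) := by
    intro y q hq
    obtain ⟨Q, h1, h2, h3⟩ := hsec y.1 (hVU y.2).1 q hq
    exact ⟨⟨fun x => Q x.1, fun x => h2 x.1 (hVU x.2).1,
      h1.continuousOn.comp_continuous continuous_subtype_val fun x => (hVU x.2).1⟩, h3⟩
  let t : C(V, E) := ⟨fun x => Φ (cotPt (0 : Cot n x.1)),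
    (IsTrivializedBy.contMDiffOn_zero tV).continuousOn.comp_continuous continuous_subtype_val
      fun x => x.2⟩
  let t' : C(V, E') := ⟨fun x => Φ' (cotPt (0 : Cot n x.1)),
    (IsTrivializedBy.contMDiffOn_zero tV').continuousOn.comp_continuous continuous_subtype_val
      fun x => x.2⟩
  obtain ⟨v, hv⟩ := hP.exists_isPotential hc hc' hε hσ hp t (fun x => tV.proj_eq x.1 x.2 0) t'
    (fun x => tV'.proj_eq x.1 x.2 0)
  refine ⟨V, Φ, Φ', fun x => if h : x ∈ V then v ⟨x, h⟩ else 0, hxV, tV, tV', ?_⟩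
  have hv' : (fun x : V => if h : x.1 ∈ V then v ⟨x.1, h⟩ else 0) = v :=
    funext fun x => dif_pos x.2
  exact hv'.symm ▸ hv

/-- Both potentials measure the same `s`, `s'` and `ε`. Corrected by the smooth differences of the
local sections, `v₁ - v₂` becomes `κ`, whose values at the ends of any path are joined by a section
of `P`. Following the paths from `x₀`, `κ` is the smooth continuation of a single lattice element.
-/
theorem IsLocalPotential.contMDiffAt_sub (hP : IsLattice k P) {s : SectionOnOneSkeleton A}
    {s' : SectionOnOneSkeleton A'} {ε : Cochain P 1} {V₁ V₂ : Set B} {Φ₁ Φ₂ : CotBundle n B → E}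
    {Φ₁' Φ₂' : CotBundle n B → E'} {v₁ v₂ : ∀ x : B, Cot n x}
    (h₁ : IsLocalPotential s s' ε V₁ Φ₁ Φ₁' v₁) (h₂ : IsLocalPotential s s' ε V₂ Φ₂ Φ₂' v₂)
    {x₀ : B} (hx₁ : x₀ ∈ V₁) (hx₂ : x₀ ∈ V₂) :
    ContMDiffAt (𝓡 n) (cotI n) ∞ (fun x => cotPt (v₁ x - v₂ x)) x₀ := by
  obtain ⟨U₀, hU₀, hx₀, hsec⟩ := hP.exists_local_sections x₀
  obtain ⟨u, N, hN, hxN, hu, hut⟩ := exists_smooth_difference h₁.triv h₂.triv hx₁ hx₂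
  obtain ⟨u', N', hN', hxN', hu', hut'⟩ := exists_smooth_difference h₁.triv' h₂.triv' hx₁ hx₂
  obtain ⟨V, hV, hVU, hxV, p, hp⟩ := exists_isStar_nhds (W := EuclideanSpace ℝ (Fin n)) x₀
    (hU₀.inter ((hN.inter hN').inter (h₁.triv.isOpen.inter h₂.triv.isOpen)))
    ⟨hx₀, ⟨hxN, hxN'⟩, hx₁, hx₂⟩
  let e₁ : C(V, V₁) := ⟨fun x => ⟨x.1, (hVU x.2).2.2.1⟩, continuous_subtype_val.subtype_mk _⟩
  let e₂ : C(V, V₂) := ⟨fun x => ⟨x.1, (hVU x.2).2.2.2⟩, continuous_subtype_val.subtype_mk _⟩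
  have k₁ : IsPotential s s' ε (inclusionMap V) (fun x => Φ₁ (cotPt (0 : Cot n x.1)))
    (fun x => Φ₁' (cotPt (0 : Cot n x.1))) (fun x => v₁ x.1) := h₁.potential.comp e₁
  have k₂ : IsPotential s s' ε (inclusionMap V) (fun x => Φ₂ (cotPt (0 : Cot n x.1)))
    (fun x => Φ₂' (cotPt (0 : Cot n x.1))) (fun x => v₂ x.1) := h₂.potential.comp e₂
  have hr := fun γ => k₁.exists_section k₂ (u := fun x => u x.1) (u' := fun x => u' x.1)
    (hu.continuousOn.comp_continuous continuous_subtype_val fun x => (hVU x.2).2.1.1)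
    (hu'.continuousOn.comp_continuous continuous_subtype_val fun x => (hVU x.2).2.1.2)
    (fun x => hut x.1 (hVU x.2).2.1.1) (fun x => hut' x.1 (hVU x.2).2.1.2) γ
  let κ : ∀ x : B, Cot n x := fun x => u' x - u x + v₁ x - v₂ x
  have hr' : ∀ γ : C(Simplex 1, V), ∃ r : Sections P ((inclusionMap V).comp γ),
      ∀ i, r.1 (vertex i) = κ (γ (vertex i)).1 := hr
  have hmem : κ x₀ ∈ P x₀ := by
    -- The constant path shows that the value at `x₀` is in the lattice.
    obtain ⟨r, hr⟩ := hr' (ContinuousMap.const _ ⟨x₀, hxV⟩)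
    have := r.2.1 (vertex 0)
    rw [hr] at this
    exact this
  obtain ⟨Q, hQ, hQP, hQx⟩ := hsec x₀ hx₀ _ hmem
  have hκ : ∀ x ∈ V, κ x = Q x := by
    intro x hx
    obtain ⟨r, hr⟩ := hr' (p ⟨x, hx⟩)
    let q : Sections P ((inclusionMap V).comp (p ⟨x, hx⟩)) :=
      ⟨fun y => Q (p ⟨x, hx⟩ y).1, fun y => hQP _ (hVU (p ⟨x, hx⟩ y).2).1,
        hQ.continuousOn.comp_continuous
          (continuous_subtype_val.comp (p ⟨x, hx⟩).continuous) fun y => (hVU (p ⟨x, hx⟩ y).2).1⟩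
    have e0 : ∀ y : B, y = x₀ → κ y = Q y := by
      rintro y rfl
      exact hQx.symm
    have e1 : r = q := hP.sections_ext (vertex 0)
      ((hr 0).trans (e0 _ (congrArg Subtype.val (hp.1 ⟨x, hx⟩))))
    have e2 : ∀ y : B, y = x → κ y = Q y → κ x = Q x := by
      rintro y rfl h
      exact h
    refine e2 _ (congrArg Subtype.val (hp.2.1 ⟨x, hx⟩)) ((hr 1).symm.trans ?_)
    rw [e1]
  have hsm : ContMDiffAt (𝓡 n) (cotI n) ∞ (fun x => cotPt (Q x - (u' x - u x))) x₀ :=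
    (hQ.contMDiffAt (hU₀.mem_nhds hx₀)).sub_section
      ((hu'.contMDiffAt (hN'.mem_nhds hxN')).sub_section (hu.contMDiffAt (hN.mem_nhds hxN)))
  refine hsm.congr_of_eventuallyEq (Filter.eventually_of_mem (hV.mem_nhds hxV) fun x hx => ?_)
  refine congrArg cotPt ?_
  rw [← hκ x hx]
  change v₁ x - v₂ x = (u' x - u x + v₁ x - v₂ x) - (u' x - u x)
  abel

/-- Affine fibrations whose obstruction cochains are cohomologous are equivalent. -/
theorem IsLattice.equivalent_of_isCoboundary [T2Space B] [SecondCountableTopology B]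
    (hP : IsLattice k P) {s : SectionOnOneSkeleton A} {s' : SectionOnOneSkeleton A'}
    {c c' : Cochain P 2} (hc : IsObstructionCochain s c) (hc' : IsObstructionCochain s' c')
    {ε : Cochain P 1} (hε : IsCoboundary ε (c - c')) : A.Equivalent A' := by
  choose V Φ Φ' v hxV hv using hP.exists_isLocalPotential hc hc' hε
  have : LocallyCompactSpace B := ChartedSpace.locallyCompactSpace (EuclideanSpace ℝ (Fin n)) B
  obtain ⟨ρ, hρ⟩ := SmoothPartitionOfUnity.exists_isSubordinate (𝓡 n) isClosed_univ V
    (fun i => (hv i).triv.isOpen) (fun x _ => mem_iUnion.2 ⟨x, hxV x⟩)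
  -- No regularity of `H` is available; only the differences `v j - H` are smooth.
  let H : ∀ x : B, Cot n x := fun x => ∑ᶠ i, ρ i x • v i x
  have hfin : ∀ x, {i | ρ i x ≠ 0}.Finite := fun x => ρ.locallyFinite.point_finite x
  have hF : ∀ j, SmoothFormOn (fun x => v j x - H x) (V j) := by
    intro j
    have heq : ∀ x, v j x - H x = ∑ᶠ i, ρ i x • (v j x - v i x) := by
      intro x
      have hs : ∀ w : B → Cot n x, (Function.support fun i => ρ i x • w i).Finite := fun w =>
        (hfin x).subset fun i hi h0 => hi (by simp only [h0]; exact zero_smul ℝ _)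
      have h1 : ∑ᶠ i, ρ i x • v j x = v j x := by
        refine (finsum_smul' (hfin x) (v j x)).symm.trans ?_
        rw [ρ.sum_eq_one (mem_univ x)]
        exact one_smul ℝ _
      have h2 : (fun i => ρ i x • (v j x - v i x)) = fun i => ρ i x • v j x - ρ i x • v i x :=
        funext fun i => smul_sub _ _ _
      rw [h2, finsum_sub_distrib (hs _) (hs _), h1]
    have hsum : ContMDiffOn (𝓡 n) (cotI n) ∞
        (fun x => cotPt (∑ᶠ i, ρ i x • (v j x - v i x))) (V j) := by
      refine ContMDiffOn.finsum_section_of_locallyFinite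
        (t := fun i x => ρ i x • (v j x - v i x)) ?_ ?_
      · refine ρ.locallyFinite.subset fun i x hx h0 => hx ?_
        simp only [h0]
        exact zero_smul ℝ _
      · intro i x hx
        refine ContMDiffAt.contMDiffWithinAt ?_
        -- On the support both potentials are defined, so their difference is smooth; off it the
        -- product vanishes near `x`.
        by_cases hxi : x ∈ tsupport (ρ i)
        · exact ContMDiffAt.smul_section (ρ i).contMDiff.contMDiffAt
            ((hv j).contMDiffAt_sub hP (hv i) hx (hρ i hxi))
        · have h0 : ContMDiffAt (𝓡 n) (cotI n) ∞ (fun x : B => cotPt (0 : Cot n x)) x :=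
            (contMDiff_zeroSection ℝ (fun x : B => Cot n x)).contMDiffAt
          refine h0.congr_of_eventuallyEq ?_
          filter_upwards [(isClosed_tsupport (ρ i)).isOpen_compl.mem_nhds hxi] with y hy
          refine congrArg cotPt ?_
          rw [image_eq_zero_of_notMem_tsupport hy]
          exact zero_smul ℝ _
    exact hsum.congr fun x _ => congrArg cotPt (heq x)
  -- Shifting the points of `s'` by `-H` replaces the potential `v j` by the smooth form `v j - H`.
  refine Compatible.equivalent (p := s.pt) (q := fun x => A'.shift (-H x) (s'.pt x) (s'.proj_pt x))
    s.proj_pt (fun x => IsShift.proj_right ⟨s'.proj_pt x, rfl⟩) fun j => ?_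
  refine ⟨V j, Φ j, Φ' j, hxV j, (hv j).triv, (hv j).triv', _, hF j, fun x hx => ?_⟩
  obtain ⟨a, ha, ha'⟩ : ∃ a : Cot n x, A.IsShift a (Φ j (cotPt (0 : Cot n x))) (s.pt x) ∧
    A'.IsShift (a + v j x) (Φ' j (cotPt (0 : Cot n x))) (s'.pt x) :=
      (hv j).potential.point ⟨x, hx⟩
  refine ⟨a, ha, ?_⟩
  have h1 : A'.IsShift (a + v j x) (Φ' j (cotPt (0 : Cot n x))) (s'.pt x) := ha'
  have h2 : A'.IsShift (-H x) (s'.pt x) (A'.shift (-H x) (s'.pt x) (s'.proj_pt x)) :=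
    ⟨s'.proj_pt x, rfl⟩
  have h3 := ((hv j).triv'.isShift_sub hx 0 (v j x - H x)).trans (h1.trans h2)
  convert h3 using 1
  abel

end Potentials

/-! ### The primary obstruction class and the classification -/

section Classes

variable {n k : ℕ} {B : Type*} [TopologicalSpace B] [ChartedSpace (EuclideanSpace ℝ (Fin n)) B]
  [IsManifold (𝓡 n) ∞ B] {P : ∀ x : B, AddSubgroup (Cot n x)}
  {E : Type*} [TopologicalSpace E] [ChartedSpace (EuclideanSpace ℝ (Fin (2 * n))) E]

theorem mk_eq_mk_iff (c c' : Cocycles P 2) :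
    (QuotientAddGroup.mk c : H2 P) = QuotientAddGroup.mk c' ↔
      ∃ g, IsCoboundary g (c'.1 - c.1) := by
  rw [QuotientAddGroup.eq, AddSubgroup.mem_addSubgroupOf]
  have h : (-c + c').1 = c'.1 - c.1 := neg_add_eq_sub c.1 c'.1
  change (-c + c').1 ∈ Coboundaries P 1 ↔ _
  rw [h]
  exact Iff.rfl

/-- The primary obstruction class exists and is unique. -/
theorem IsLattice.exists_primaryObstructionClass (hP : IsLattice k P) (A : AffineFibration P E) :
    ∃ (s : SectionOnOneSkeleton A) (c : Cocycles P 2), IsObstructionCochain s c.1 ∧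
      ∀ γ, A.IsPrimaryObstructionClass γ ↔ γ = QuotientAddGroup.mk c := by
  obtain ⟨s⟩ := hP.exists_sectionOnOneSkeleton A
  obtain ⟨c, hc⟩ := hP.exists_isObstructionCochain s
  refine ⟨s, ⟨c, hP.isCoboundary_zero hc⟩, hc, fun γ => ⟨?_, fun h => ⟨s, _, hc, h⟩⟩⟩
  rintro ⟨s', c', hc', rfl⟩
  exact (mk_eq_mk_iff _ _).2 (hP.exists_isCoboundary_sub hc' hc)

end Classes

end LatticeFibration

theorem theorem7 {n k : ℕ} {B : Type*} [TopologicalSpace B] [T2Space B]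
    [SecondCountableTopology B] [ChartedSpace (EuclideanSpace ℝ (Fin n)) B]
    [IsManifold (𝓡 n) ∞ B] (P : ∀ x : B, AddSubgroup (Cot n x)) (hP : IsClosedLattice k P)
    {E₁ : Type*} [TopologicalSpace E₁] [ChartedSpace (EuclideanSpace ℝ (Fin (2 * n))) E₁]
    [IsManifold (𝓡 (2 * n)) ∞ E₁] (A₁ : AffineFibration P E₁)
    {E₂ : Type*} [TopologicalSpace E₂] [ChartedSpace (EuclideanSpace ℝ (Fin (2 * n))) E₂]
    [IsManifold (𝓡 (2 * n)) ∞ E₂] (A₂ : AffineFibration P E₂) :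
    ∃ γ₁ γ₂ : H2 P,
      (∀ γ, A₁.IsPrimaryObstructionClass γ ↔ γ = γ₁) ∧
      (∀ γ, A₂.IsPrimaryObstructionClass γ ↔ γ = γ₂) ∧
      (A₁.Equivalent A₂ ↔ γ₁ = γ₂) := by
  obtain ⟨s₁, c₁, hc₁, h₁⟩ := hP.isLattice.exists_primaryObstructionClass A₁
  obtain ⟨s₂, c₂, hc₂, h₂⟩ := hP.isLattice.exists_primaryObstructionClass A₂
  refine ⟨_, _, h₁, h₂, fun h => ?_, fun h => ?_⟩
  · obtain ⟨s, hs⟩ := h.exists_isObstructionCochain s₁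
    -- The transported section has cochain `c₁`, so the class of `c₁` is also a primary obstruction
    -- class of the second fibration, which has only one.
    exact (h₂ _).1 ⟨s, c₁, hs _ hc₁, rfl⟩
  · obtain ⟨ε, hε⟩ := (mk_eq_mk_iff _ _).1 h.symm
    exact hP.isLattice.equivalent_of_isCoboundary hc₁ hc₂ hε
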